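/- Let $n,d,m\ge 1$, let $A\in\mathbb R^{d\times m}$ have rank $d$ (so $m\ge d$), and let $\Delta_1,\dots,\Delta_n\in\mathbb R^{d\times m}$ be arbitrary. Write $\|\cdot\|$ for the operator norm, $\|\cdot\|_F$ for the Frobenius norm, $\sigma_{\min}(A)=\sigma_d(A)>0$ for the smallest singular value of $A$, $\kappa=\|A\|/\sigma_{\min}(A)$ for its condition number, and $O(d)$ for the group of orthogonal $d\times d$ matrices. Let $Z\in\mathbb R^{nd\times d}$ be the vertical stack of $n$ copies of $I_d$, let $D\in\mathbb R^{nd\times m}$ be the vertical stack of the matrices $A_i=A+\Delta_i$, and put $C=DD^\top\in\mathbb R^{nd\times nd}$. Let $O(d)^{\otimes n}\subset\mathbb R^{nd\times d}$ be the set of vertical stacks $S$ of $n$ orthogonal blocks $S_1,\dots,S_n\in O(d)$. For $X,Y\in\mathbb R^{nd\times d}$ let $$d_F(X,Y)=\min_{Q\in O(d)}\|X-YQ\|_F,$$ and for real $\epsilon$ let $$\mathcal N_\epsilon=\{S\in O(d)^{\otimes n}:\ d_F(S,Z)\le\epsilon\sqrt{nd}\}.$$ For $X\in\mathbb R^{d\times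 d}$ let $\mathcal P(X)$ be a minimizer of $\|R-X\|_F^2$ over $R\in O(d)$ (any minimizer, if there are several), and let $\mathcal P_n$ apply $\mathcal P$ to each of the $n$ blocks of a matrix in $\mathbb R^{nd\times d}$. The generalized power method (GPM) started at $S^0$ is the iteration $S^{t+1}=\mathcal P_n(CS^t)$, $t\ge0$. The semidefinite program (SDP) is $$\max\ \langle C,G\rangle=\operatorname{Tr}(C^\top G)\quad\text{subject to}\quad G\in\mathbb R^{nd\times nd},\ G\succeq0,\ G_{ii}=I_d\ (1\le i\le n),$$ where $G_{ii}$ is the $i$-th diagonal $d\times d$ block of $G$. Theorem. Suppose that $$\max_{1\le i\le n}\|\Delta_i\|\le\frac{\sigma_{\min}(A)}{192\,\kappa^3}.$$ Then there is $S^\infty\in O(d)^{\otimes n}$ that is a fixed point of the GPM, in the sense that $\mathcal P_n(CS^\infty)$ is uniquely determined and equals $S^\infty$, such that $S^\infty(S^\infty)^\top$ is the unique global maximizer of the SDP, and such that the following holds for every $\epsilon\le\frac{1}{16\kappa^2\sqrt d}$. Put $$\rho=4\kappa^2\left(2\epsilon\sqrt d+\frac{3\max_{1\le i\le n}\|\Delta_i\|}{\|A\|}\right).$$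 1. $\rho<1$. 2. Every fixed point of the GPM in $\mathcal N_\epsilon$ is of the form $S^\infty Q$ with $Q\in O(d)$. 3. If $S^0\in\mathcal N_\epsilon$, then all GPM iterates started at $S^0$ satisfy $$d_F(S^t,S^\infty)\le\rho^t\,d_F(S^0,S^\infty)\qquad\text{for all }t\ge0,$$ and every $S'\in O(d)^{\otimes n}$ with $d_F(S^t,S')\to0$ is of the form $S^\infty Q$ with $Q\in O(d)$. -/

import Mathlib

noncomputable section

/- The set-up of the generalized orthogonal Procrustes problem.  A vertical stack of `n` blocks
with `d` rows each is a matrix whose rows are indexed by `Fin n × Fin d`: the row `(i, a)` is the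
`a`-th row of the `i`-th block. -/
namespace Procrustes

/-- The vertical stack of the blocks `B 0, …, B (n - 1)`. -/
def stack {n d k : ℕ} (B : Fin n → Matrix (Fin d) (Fin k) ℝ) :
    Matrix (Fin n × Fin d) (Fin k) ℝ :=
  Matrix.of fun p j => B p.1 p.2 j

/-- The `i`-th block of a stack. -/
def block {n d k : ℕ} (S : Matrix (Fin n × Fin d) (Fin k) ℝ) (i : Fin n) :
    Matrix (Fin d) (Fin k) ℝ :=
  Matrix.of fun a j => S (i, a) j

/-- The Frobenius norm. -/
def frob {p q : Type*} [Fintype p] [Fintype q] (X : Matrix p q ℝ) : ℝ :=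
  √(∑ i, ∑ j, X i j ^ 2)

/-- The operator norm with respect to the Euclidean norms. -/
def opNorm {p q : ℕ} (X : Matrix (Fin p) (Fin q) ℝ) : ℝ :=
  ‖LinearMap.toContinuousLinearMap (Matrix.toEuclideanLin X)‖

/-- The smallest singular value `σ_d(A)` of a `d × m` matrix with `d ≤ m`; it is positive exactly
when `A` has rank `d`.  `A` and `Aᵀ` have the same `d` largest singular values, and those of the map
`Aᵀ : ℝ^d → ℝ^m` are the square roots of the `d` eigenvalues of `A Aᵀ`.
Mathlib counts singular values from `0`, in decreasing order. -/
def sigmaMin {d m : ℕ} (A : Matrix (Fin d) (Fin m) ℝ) : ℝ :=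
  (Matrix.toEuclideanLin A.transpose).singularValues (d - 1)

/-- The condition number `σ_max(A) / σ_min(A)`. -/
def kappa {d m : ℕ} (A : Matrix (Fin d) (Fin m) ℝ) : ℝ :=
  opNorm A / sigmaMin A

/-- `Z`, the stack of `n` identity matrices. -/
def Zmat (n d : ℕ) : Matrix (Fin n × Fin d) (Fin d) ℝ :=
  stack fun _ => 1

/-- The observed clouds `D = Z A + Δ`, that is, the stack of the `A_i = A + Δ_i`. -/
def dataD {n d m : ℕ} (A : Matrix (Fin d) (Fin m) ℝ) (Δ : Fin n → Matrix (Fin d) (Fin m) ℝ) :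
    Matrix (Fin n × Fin d) (Fin m) ℝ :=
  Zmat n d * A + stack Δ

/-- The data matrix `C = D Dᵀ`, with blocks `C_ij = A_i A_jᵀ`. -/
def dataC {n d m : ℕ} (A : Matrix (Fin d) (Fin m) ℝ) (Δ : Fin n → Matrix (Fin d) (Fin m) ℝ) :
    Matrix (Fin n × Fin d) (Fin n × Fin d) ℝ :=
  dataD A Δ * (dataD A Δ).transpose

/-- `S ∈ O(d)^{⊗ n}`: every block of `S` is an orthogonal matrix. -/
def IsOrthStack {n d : ℕ} (S : Matrix (Fin n × Fin d) (Fin d) ℝ) : Prop :=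
  ∀ i, block S i ∈ Matrix.orthogonalGroup (Fin d) ℝ

/-- `d_F(X, Y)`, the minimum of `‖X - Y Q‖_F` over the orthogonal matrices `Q` (attained, since
`O(d)` is compact). -/
def dF {n d : ℕ} (X Y : Matrix (Fin n × Fin d) (Fin d) ℝ) : ℝ :=
  ⨅ Q : Matrix.orthogonalGroup (Fin d) ℝ, frob (X - Y * (Q : Matrix (Fin d) (Fin d) ℝ))

/-- The neighbourhood `N_ε` of the synchronized states `Z Q`. -/
def Nbhd (n d : ℕ) (ε : ℝ) : Set (Matrix (Fin n × Fin d) (Fin d) ℝ) :=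
  {S | IsOrthStack S ∧ dF S (Zmat n d) ≤ ε * √((n : ℝ) * d)}

/-- `R` is a value of the projection `P(X)`: it minimizes `‖R - X‖_F²` over `O(d)`. -/
def IsProj {d : ℕ} (X R : Matrix (Fin d) (Fin d) ℝ) : Prop :=
  R ∈ Matrix.orthogonalGroup (Fin d) ℝ ∧
    ∀ R' ∈ Matrix.orthogonalGroup (Fin d) ℝ, frob (R - X) ^ 2 ≤ frob (R' - X) ^ 2

/-- `T` is a value of `P_n(C S)`, where `P_n` projects every block.  (The value is unique when the
blocks of `C S` are invertible; otherwise every choice of the minimizers is allowed.) -/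
def IsGPMStep {n d : ℕ} (C : Matrix (Fin n × Fin d) (Fin n × Fin d) ℝ)
    (S T : Matrix (Fin n × Fin d) (Fin d) ℝ) : Prop :=
  ∀ i, IsProj (block (C * S) i) (block T i)

/-- `S 0, S 1, …` is a run of the generalized power method `S (t+1) = P_n(C (S t))`. -/
def IsGPM {n d : ℕ} (C : Matrix (Fin n × Fin d) (Fin n × Fin d) ℝ)
    (S : ℕ → Matrix (Fin n × Fin d) (Fin d) ℝ) : Prop :=
  ∀ t, IsGPMStep C (S t) (S (t + 1))

/-- `G` is feasible for the semidefinite relaxation: `G ⪰ 0` and `G_ii = I_d` for all `i`. -/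
def SDPFeasible {n d : ℕ} (G : Matrix (Fin n × Fin d) (Fin n × Fin d) ℝ) : Prop :=
  G.PosSemidef ∧
    ∀ i, (Matrix.of fun a b => G (i, a) (i, b) : Matrix (Fin d) (Fin d) ℝ) = 1

/-- The inner product `⟨C, G⟩ = Tr(Cᵀ G)`, the objective of the semidefinite relaxation. -/
def sdpObj {n d : ℕ} (C G : Matrix (Fin n × Fin d) (Fin n × Fin d) ℝ) : ℝ :=
  (C.transpose * G).trace

/-- `G` is the unique global maximizer of `⟨C, ·⟩` over the feasible set. -/
def IsUniqueSDPMaximizer {n d : ℕ} (C G : Matrix (Fin n × Fin d) (Fin n × Fin d) ℝ) : Prop :=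
  SDPFeasible G ∧ ∀ G', SDPFeasible G' → G' ≠ G → sdpObj C G' < sdpObj C G

/-- The rate `ρ = 4 κ² (2 ε √d + 3 max_i ‖Δ_i‖ / ‖A‖)`. -/
def rho {n d m : ℕ} (A : Matrix (Fin d) (Fin m) ℝ) (Δ : Fin n → Matrix (Fin d) (Fin m) ℝ)
    (ε : ℝ) : ℝ :=
  4 * kappa A ^ 2 * (2 * ε * √(d : ℝ) + 3 * (⨆ i, opNorm (Δ i)) / opNorm A)

end Procrustes

end

/-!
Write `A i = A + Δ i` for the blocks of `D`.  A step of the power method replaces the block `S i` of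
a stack by a polar factor of `A i * M`, where `M = corr A S` is `n⁻¹ Dᵀ S`: the nearest orthogonal
matrices to `X` are the orthogonal `R` with `Rᵀ X` symmetric positive semidefinite (`IsPolar`,
`isProj_iff_isPolar`, `isGPMStep_iff`).  Put `x = max ‖Δ i‖ / ‖A‖`, so that `κ ^ 4 * x ≤ 1 / 192`.
Everything rests on perturbation bounds for polar factors, one in operator norm
(`IsPolar.norm_sub_one_le`) and one in Frobenius norm (`IsPolar.frob_sub_one_le`,
`IsPolar.frob_sub_one_le_of_gram`).

*Fixed point.*  If the mean of the blocks of `S` is close to an orthogonal matrix, then one step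
brings all blocks within `O(κ² x)` of a common orthogonal matrix, whatever `S` was
(`SmallNoise.norm_step_sub_le`).  So the step maps the compact tube of such stacks to itself.  It
does not decrease the convex function `‖Dᵀ S‖_F`, hence a maximizer of this function over the tube
is a fixed point (`exists_fixedPoint_of_mapsTo`).  In the right gauge its blocks are even within
`O(κ x)` of the identity (`norm_fixedPoint_sub_one_le`); the factor `κ` saved
here is needed for the rate `ρ`.

*Contraction.*  Rotate the data by the fixed point, `B i = (S∞ i)ᵀ A i`.  The fixed-point equation
says that all `B i * (mean B)ᵀ` are symmetric.  For another stack, with relative rotations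
`V i = (S∞ i)ᵀ S i`, compare every new block with one matrix, the polar factor of
`mean B * corr B V`.  First-order terms cancel, and the difference is bilinear in the spreads and
in `d_F(S, S∞)` (`exists_frob_step_sub_le`); the optimal gauge makes `mean V` positive semidefinite,
so it differs from `1` only to second order (`frob_one_sub_mean_le`).  The rate obtained is
`t / 2 + 3 κ x`, where `t` is the spread of the blocks of `S` (`SmallNoise.dF_step_le`).  The
iterates may leave `N_ε` when `ε` is small against `x`, but their spread is `O(κ² x)` after one
step, and `ρ` has room for this (`SmallNoise.dF_run_le`).

A fixed point in `N_ε` is the start of a constant run, so it is at distance zero from the orbit of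
`S∞`; the same holds for a limit of a run, by the triangle inequality for `dF`.

*Semidefinite program.*  The certificate is the block diagonal `Λ` with `i`-th block
`(C S∞) i (S∞ i)ᵀ`.  After rotation, `Λ - C` is positive definite off the range of
`S∞`, since all `B i` are close to their mean, which is bounded below (`mean_sq_sub_mean_le`).
This makes `S∞ S∞ᵀ` the only maximizer (`isUniqueSDPMaximizer_of_fixedPoint`).
-/

noncomputable section

namespace Procrustes

open Matrix
open scoped Matrix.Norms.L2Operator

set_option linter.unusedSectionVars false

section
variable {ι κ l : Type*} [Fintype ι] [Fintype κ] [Fintype l]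

/-! ### Euclidean, operator and Frobenius norms -/

/-- The Euclidean norm of a coordinate vector. -/
def l2 (u : ι → ℝ) : ℝ := ‖WithLp.toLp 2 u‖

lemma l2_nonneg (u : ι → ℝ) : 0 ≤ l2 u := norm_nonneg _

lemma l2_sq (u : ι → ℝ) : l2 u ^ 2 = u ⬝ᵥ u := by
  rw [l2, EuclideanSpace.norm_sq_eq]
  simp [dotProduct, sq]

lemma l2_eq_sqrt (u : ι → ℝ) : l2 u = √(u ⬝ᵥ u) := by
  rw [← l2_sq, Real.sqrt_sq (l2_nonneg u)]

lemma l2_add_le (u v : ι → ℝ) : l2 (u + v) ≤ l2 u + l2 v := by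
  simp only [l2, WithLp.toLp_add]; exact norm_add_le _ _

lemma l2_neg (u : ι → ℝ) : l2 (-u) = l2 u := by
  simp only [l2, WithLp.toLp_neg]; exact norm_neg _

lemma l2_sub_le (u v : ι → ℝ) : l2 (u - v) ≤ l2 u + l2 v := by
  simp only [l2, WithLp.toLp_sub]; exact norm_sub_le _ _

lemma l2_smul (c : ℝ) (u : ι → ℝ) : l2 (c • u) = |c| * l2 u := by
  simp only [l2, WithLp.toLp_smul]; exact norm_smul _ _

lemma l2_eq_zero {u : ι → ℝ} : l2 u = 0 ↔ u = 0 := by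
  simp [l2]

lemma l2_pos {u : ι → ℝ} (h : u ≠ 0) : 0 < l2 u :=
  lt_of_le_of_ne (l2_nonneg u) (fun h0 => h (l2_eq_zero.1 h0.symm))

lemma abs_dotProduct_le (u v : ι → ℝ) : |u ⬝ᵥ v| ≤ l2 u * l2 v := by
  have := abs_real_inner_le_norm (WithLp.toLp 2 v : EuclideanSpace ℝ ι) (WithLp.toLp 2 u)
  simpa [EuclideanSpace.inner_eq_star_dotProduct, l2, mul_comm] using this

lemma dotProduct_le (u v : ι → ℝ) : u ⬝ᵥ v ≤ l2 u * l2 v :=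
  (le_abs_self _).trans (abs_dotProduct_le u v)

lemma neg_le_dotProduct (u v : ι → ℝ) : -(l2 u * l2 v) ≤ u ⬝ᵥ v :=
  neg_le_of_abs_le (abs_dotProduct_le u v)

lemma dotProduct_mulVec_comm (A : Matrix ι κ ℝ) (u : ι → ℝ) (v : κ → ℝ) :
    u ⬝ᵥ A *ᵥ v = (Aᵀ *ᵥ u) ⬝ᵥ v := by
  rw [dotProduct_mulVec, mulVec_transpose]

lemma l2_mulVec_sq (A : Matrix ι κ ℝ) (u : κ → ℝ) :
    l2 (A *ᵥ u) ^ 2 = u ⬝ᵥ (Aᵀ * A) *ᵥ u := by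
  rw [l2_sq, ← mulVec_mulVec, dotProduct_mulVec_comm Aᵀ, transpose_transpose]

section
variable [DecidableEq ι] [DecidableEq κ] [DecidableEq l]

lemma l2_mulVec_le (A : Matrix ι κ ℝ) (u : κ → ℝ) : l2 (A *ᵥ u) ≤ ‖A‖ * l2 u :=
  l2_opNorm_mulVec A (WithLp.toLp 2 u)

lemma norm_le_of_l2 {A : Matrix ι κ ℝ} {c : ℝ} (hc : 0 ≤ c)
    (h : ∀ u, l2 (A *ᵥ u) ≤ c * l2 u) : ‖A‖ ≤ c := by
  rw [l2_opNorm_def]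
  refine ContinuousLinearMap.opNorm_le_bound _ hc fun x => ?_
  exact h (WithLp.ofLp x)

lemma norm_transpose (A : Matrix ι κ ℝ) : ‖Aᵀ‖ = ‖A‖ := by
  rw [← conjTranspose_eq_transpose_of_trivial, l2_opNorm_conjTranspose]

lemma norm_mul_le' (A : Matrix ι κ ℝ) (B : Matrix κ l ℝ) : ‖A * B‖ ≤ ‖A‖ * ‖B‖ :=
  l2_opNorm_mul A B

lemma l2_ortho_mulVec {R : Matrix ι ι ℝ} (hR : Rᵀ * R = 1) (u : ι → ℝ) :
    l2 (R *ᵥ u) = l2 u := by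
  have := l2_mulVec_sq R u
  rw [hR, one_mulVec, ← l2_sq] at this
  exact (sq_eq_sq₀ (l2_nonneg _) (l2_nonneg _)).1 this

lemma ortho_transpose {R : Matrix ι ι ℝ} (hR : Rᵀ * R = 1) : Rᵀᵀ * Rᵀ = 1 := by
  rw [transpose_transpose]; exact mul_eq_one_comm.1 hR

lemma ortho_mul {R S : Matrix ι ι ℝ} (hR : Rᵀ * R = 1) (hS : Sᵀ * S = 1) :
    (R * S)ᵀ * (R * S) = 1 := by
  rw [transpose_mul, Matrix.mul_assoc, ← Matrix.mul_assoc Rᵀ, hR, Matrix.one_mul, hS]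

lemma norm_ortho_le {R : Matrix ι ι ℝ} (hR : Rᵀ * R = 1) : ‖R‖ ≤ 1 :=
  norm_le_of_l2 zero_le_one fun u => by rw [l2_ortho_mulVec hR, one_mul]

end

lemma frob_eq_l2 (X : Matrix ι κ ℝ) : frob X = l2 (fun p : ι × κ => X p.1 p.2) := by
  rw [l2_eq_sqrt, frob]
  simp [dotProduct, Fintype.sum_prod_type, sq]

lemma frob_nonneg (X : Matrix ι κ ℝ) : 0 ≤ frob X := Real.sqrt_nonneg _

lemma frob_sq (X : Matrix ι κ ℝ) : frob X ^ 2 = ∑ i, ∑ j, X i j ^ 2 :=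
  Real.sq_sqrt (by positivity)

lemma frob_sq_eq_trace (X : Matrix ι κ ℝ) : frob X ^ 2 = (Xᵀ * X).trace := by
  rw [frob_sq, Finset.sum_comm]
  simp [trace, Matrix.mul_apply, sq]

lemma frob_add_le (X Y : Matrix ι κ ℝ) : frob (X + Y) ≤ frob X + frob Y := by
  simp only [frob_eq_l2]; exact l2_add_le _ _

lemma frob_neg (X : Matrix ι κ ℝ) : frob (-X) = frob X := by
  simp only [frob_eq_l2]; exact l2_neg _

lemma frob_sub_le (X Y : Matrix ι κ ℝ) : frob (X - Y) ≤ frob X + frob Y := by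
  simp only [frob_eq_l2]; exact l2_sub_le _ _

lemma frob_sub_comm (X Y : Matrix ι κ ℝ) : frob (X - Y) = frob (Y - X) := by
  rw [← frob_neg, neg_sub]

lemma frob_smul (c : ℝ) (X : Matrix ι κ ℝ) : frob (c • X) = |c| * frob X := by
  simp only [frob_eq_l2]; exact l2_smul c _

lemma frob_zero : frob (0 : Matrix ι κ ℝ) = 0 := by simp [frob]

lemma frob_eq_zero {X : Matrix ι κ ℝ} : frob X = 0 ↔ X = 0 := by
  rw [frob_eq_l2, l2_eq_zero]
  exact ⟨fun h => by ext i j; exact congrFun h (i, j), fun h => by subst h; rfl⟩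

lemma frob_sum_le {α : Type*} (s : Finset α) (X : α → Matrix ι κ ℝ) :
    frob (∑ i ∈ s, X i) ≤ ∑ i ∈ s, frob (X i) := by
  classical
  induction s using Finset.induction_on with
  | empty => simp [frob_zero]
  | insert a s ha ih =>
    rw [Finset.sum_insert ha, Finset.sum_insert ha]
    exact (frob_add_le _ _).trans (by gcongr)

lemma frob_transpose (X : Matrix ι κ ℝ) : frob Xᵀ = frob X := by
  simp only [frob, transpose_apply]
  rw [Finset.sum_comm]

lemma trace_transpose_mul_le (X Y : Matrix ι κ ℝ) : (Xᵀ * Y).trace ≤ frob X * frob Y := by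
  have : (Xᵀ * Y).trace = (fun p : ι × κ => X p.1 p.2) ⬝ᵥ (fun p : ι × κ => Y p.1 p.2) := by
    simp only [dotProduct, Fintype.sum_prod_type, trace, diag_apply, Matrix.mul_apply,
      transpose_apply]
    rw [Finset.sum_comm]
  rw [this, frob_eq_l2, frob_eq_l2]
  exact dotProduct_le _ _

lemma frob_sq_eq_sum_col (X : Matrix ι κ ℝ) : frob X ^ 2 = ∑ j, l2 (fun i => X i j) ^ 2 := by
  rw [frob_sq, Finset.sum_comm]
  exact Finset.sum_congr rfl fun j _ => by rw [l2_sq]; simp [dotProduct, sq]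

section
variable [DecidableEq ι] [DecidableEq κ] [DecidableEq l]

lemma frob_mul_le (A : Matrix ι κ ℝ) (B : Matrix κ l ℝ) : frob (A * B) ≤ ‖A‖ * frob B := by
  refine le_of_sq_le_sq ?_ (mul_nonneg (norm_nonneg _) (frob_nonneg _))
  rw [mul_pow, frob_sq_eq_sum_col, frob_sq_eq_sum_col, Finset.mul_sum]
  refine Finset.sum_le_sum fun j _ => ?_
  rw [← mul_pow]
  exact pow_le_pow_left₀ (l2_nonneg _) (l2_mulVec_le A (fun i => B i j)) 2

lemma frob_mul_le' (A : Matrix ι κ ℝ) (B : Matrix κ l ℝ) : frob (A * B) ≤ frob A * ‖B‖ := by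
  rw [← frob_transpose, transpose_mul, ← frob_transpose A, ← norm_transpose B, mul_comm]
  exact frob_mul_le _ _

lemma frob_ortho_mul {R : Matrix ι ι ℝ} (hR : Rᵀ * R = 1) (X : Matrix ι κ ℝ) :
    frob (R * X) = frob X := by
  refine (sq_eq_sq₀ (frob_nonneg _) (frob_nonneg _)).1 ?_
  rw [frob_sq_eq_trace, frob_sq_eq_trace, transpose_mul, Matrix.mul_assoc, ← Matrix.mul_assoc Rᵀ,
    hR, Matrix.one_mul]

lemma frob_mul_ortho {R : Matrix κ κ ℝ} (hR : Rᵀ * R = 1) (X : Matrix ι κ ℝ) :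
    frob (X * R) = frob X := by
  rw [← frob_transpose, transpose_mul, frob_ortho_mul (ortho_transpose hR), frob_transpose]

lemma norm_le_frob (X : Matrix ι κ ℝ) : ‖X‖ ≤ frob X := by
  refine norm_le_of_l2 (frob_nonneg _) fun u => ?_
  have h : l2 (X *ᵥ u) = frob (X * (Matrix.of fun i (_ : Unit) => u i)) := by
    refine (sq_eq_sq₀ (l2_nonneg _) (frob_nonneg _)).1 ?_
    rw [frob_sq_eq_sum_col]; simp; rfl
  have h' : l2 u = frob (Matrix.of fun i (_ : Unit) => u i) := by
    refine (sq_eq_sq₀ (l2_nonneg _) (frob_nonneg _)).1 ?_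
    rw [frob_sq_eq_sum_col]; simp
  rw [h, h']
  -- `‖X Y‖_F ≤ ‖X‖_F ‖Y‖_F` by Cauchy-Schwarz in each entry
  refine le_of_sq_le_sq ?_ (mul_nonneg (frob_nonneg _) (frob_nonneg _))
  rw [mul_pow, frob_sq X, frob_sq, Finset.sum_mul]
  refine Finset.sum_le_sum fun i _ => ?_
  simp only [Finset.univ_unique, Finset.sum_singleton, Matrix.mul_apply, of_apply]
  rw [frob_sq]
  simpa using Finset.sum_mul_sq_le_sq_mul_sq Finset.univ (X i) u

end

end

section
variable {ι κ : Type*} [Fintype ι] [Fintype κ] [DecidableEq ι] [DecidableEq κ]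

/-! ### Polar factors -/

/-- `R` is a polar factor of the square matrix `X`: it is orthogonal and `Rᵀ X` is symmetric
positive semidefinite.  When `X` is singular there may be several polar factors. -/
structure IsPolar (X R : Matrix ι ι ℝ) : Prop where
  ortho : Rᵀ * R = 1
  symm : (Rᵀ * X)ᵀ = Rᵀ * X
  nonneg : ∀ u, 0 ≤ u ⬝ᵥ (Rᵀ * X) *ᵥ u

lemma mem_orthogonalGroup_iff_transpose {R : Matrix ι ι ℝ} :
    R ∈ Matrix.orthogonalGroup ι ℝ ↔ Rᵀ * R = 1 := by
  rw [mem_orthogonalGroup_iff']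

lemma dotProduct_transpose_mul_mulVec (Y : Matrix κ ι ℝ) (X : Matrix κ ι ℝ) (u v : ι → ℝ) :
    u ⬝ᵥ (Yᵀ * X) *ᵥ v = (Y *ᵥ u) ⬝ᵥ X *ᵥ v := by
  rw [← mulVec_mulVec, dotProduct_mulVec_comm, transpose_transpose]

lemma dotProduct_mulVec_symm {H : Matrix ι ι ℝ} (hH : Hᵀ = H) (u v : ι → ℝ) :
    u ⬝ᵥ H *ᵥ v = v ⬝ᵥ H *ᵥ u := by
  rw [dotProduct_mulVec_comm, hH, dotProduct_comm]

namespace IsPolar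

variable {X R Q : Matrix ι ι ℝ}

lemma smul (h : IsPolar X R) {c : ℝ} (hc : 0 ≤ c) : IsPolar (c • X) R where
  ortho := h.ortho
  symm := by rw [Matrix.mul_smul, transpose_smul, h.symm]
  nonneg u := by
    rw [Matrix.mul_smul, smul_mulVec, dotProduct_smul]
    exact mul_nonneg hc (h.nonneg u)

lemma mul_left (h : IsPolar X R) (hQ : Qᵀ * Q = 1) : IsPolar (Q * X) (Q * R) := by
  have e : (Q * R)ᵀ * (Q * X) = Rᵀ * X := by
    rw [transpose_mul, Matrix.mul_assoc, ← Matrix.mul_assoc Qᵀ, hQ, Matrix.one_mul]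
  exact ⟨ortho_mul hQ h.ortho, by rw [e, h.symm], fun u => by rw [e]; exact h.nonneg u⟩

lemma mul_right (h : IsPolar X R) (hQ : Qᵀ * Q = 1) : IsPolar (X * Q) (R * Q) := by
  have e : (R * Q)ᵀ * (X * Q) = Qᵀ * ((Rᵀ * X) * Q) := by
    rw [transpose_mul]; simp only [Matrix.mul_assoc]
  refine ⟨ortho_mul h.ortho hQ, ?_, fun u => ?_⟩
  · rw [e]; rw [transpose_mul, transpose_mul, h.symm, transpose_transpose, Matrix.mul_assoc]
  · rw [e, dotProduct_transpose_mul_mulVec, ← mulVec_mulVec]; exact h.nonneg _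

end IsPolar

lemma trace_mul_mul_transpose (Y : Matrix κ ι ℝ) (H : Matrix ι ι ℝ) :
    (Y * H * Yᵀ).trace = ∑ i, Y i ⬝ᵥ H *ᵥ Y i := by
  simp only [trace, diag_apply]
  refine Finset.sum_congr rfl fun i _ => ?_
  rw [Matrix.mul_apply, dotProduct_mulVec]
  rfl

lemma le_trace_mul_mul_transpose (Y : Matrix κ ι ℝ) {H : Matrix ι ι ℝ} {h : ℝ}
    (hH : ∀ u, h * l2 u ^ 2 ≤ u ⬝ᵥ H *ᵥ u) : h * frob Y ^ 2 ≤ (Y * H * Yᵀ).trace := by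
  rw [trace_mul_mul_transpose, ← frob_transpose, frob_sq_eq_sum_col, Finset.mul_sum]
  exact Finset.sum_le_sum fun i _ => hH _

/-- The loss `tr H - tr (Rᵀ H)` caused by a rotation is a quadratic form in `R - 1`. -/
lemma trace_sub_trace_ortho {R H : Matrix ι ι ℝ} (hR : Rᵀ * R = 1) (hH : Hᵀ = H) :
    H.trace - (Rᵀ * H).trace = (1 / 2) * ((R - 1) * H * (R - 1)ᵀ).trace := by
  have h1 : (R * H * Rᵀ).trace = H.trace := by
    rw [Matrix.mul_assoc, trace_mul_comm, Matrix.mul_assoc, hR, Matrix.mul_one]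
  have h2 : (R * H).trace = (Rᵀ * H).trace := by
    rw [← trace_transpose, transpose_mul, hH, trace_mul_comm]
  have h3 : (H * Rᵀ).trace = (Rᵀ * H).trace := trace_mul_comm _ _
  have : (R - 1) * H * (R - 1)ᵀ = R * H * Rᵀ - R * H - H * Rᵀ + H := by
    rw [transpose_sub, transpose_one]; noncomm_ring
  rw [this, trace_add, trace_sub, trace_sub, h1, h2, h3]
  ring

/-- A polar factor maximizes `tr (Uᵀ X)` over the orthogonal matrices `U`. -/
lemma IsPolar.trace_le {X R U : Matrix ι ι ℝ} (h : IsPolar X R) (hU : Uᵀ * U = 1) :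
    (Uᵀ * X).trace ≤ (Rᵀ * X).trace := by
  have hO : (Rᵀ * U)ᵀ * (Rᵀ * U) = 1 := ortho_mul (ortho_transpose h.ortho) hU
  have h1 := trace_sub_trace_ortho hO h.symm
  have h2 := le_trace_mul_mul_transpose (Rᵀ * U - 1) (H := Rᵀ * X) (h := 0)
    (fun u => by rw [zero_mul]; exact h.nonneg u)
  have h3 : (Rᵀ * U)ᵀ * (Rᵀ * X) = Uᵀ * X := by
    rw [transpose_mul, transpose_transpose, Matrix.mul_assoc, ← Matrix.mul_assoc R,
      mul_eq_one_comm.1 h.ortho, Matrix.one_mul]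
  rw [h3] at h1
  linarith

lemma frob_sub_sq {R : Matrix ι ι ℝ} (hR : Rᵀ * R = 1) (X : Matrix ι ι ℝ) :
    frob (R - X) ^ 2 = (1 : Matrix ι ι ℝ).trace - 2 * (Rᵀ * X).trace + frob X ^ 2 := by
  have h : (Xᵀ * R).trace = (Rᵀ * X).trace := by
    rw [← trace_transpose, transpose_mul, transpose_transpose]
  have : (R - X)ᵀ * (R - X) = Rᵀ * R - Rᵀ * X - Xᵀ * R + Xᵀ * X := by
    rw [transpose_sub]; noncomm_ring
  rw [frob_sq_eq_trace, frob_sq_eq_trace, this, hR, trace_add, trace_sub, trace_sub, h]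
  ring

lemma exists_isMax_trace (X : Matrix ι ι ℝ) :
    ∃ R : Matrix ι ι ℝ, Rᵀ * R = 1 ∧ ∀ U : Matrix ι ι ℝ, Uᵀ * U = 1 →
      (Uᵀ * X).trace ≤ (Rᵀ * X).trace := by
  have : ProperSpace (Matrix ι ι ℝ) := FiniteDimensional.proper ℝ _
  have hc : IsCompact {R : Matrix ι ι ℝ | Rᵀ * R = 1} := by
    refine Metric.isCompact_of_isClosed_isBounded ?_ ?_
    · exact isClosed_eq (by fun_prop) continuous_const
    · refine (Metric.isBounded_closedBall (x := (0 : Matrix ι ι ℝ)) (r := 1)).subset ?_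
      intro R hR
      rw [mem_closedBall_zero_iff]
      exact norm_ortho_le hR
  obtain ⟨R, hR, hmax⟩ := hc.exists_isMaxOn ⟨1, by simp⟩
    (f := fun U : Matrix ι ι ℝ => (Uᵀ * X).trace) (by fun_prop)
  exact ⟨R, hR, fun U hU => hmax hU⟩

/-- The Householder reflection in the hyperplane orthogonal to `w`. -/
def householder (w : ι → ℝ) : Matrix ι ι ℝ := 1 - (2 / (w ⬝ᵥ w)) • vecMulVec w w

lemma householder_transpose (w : ι → ℝ) : (householder w)ᵀ = householder w := by
  rw [householder, transpose_sub, transpose_smul, transpose_one, transpose_vecMulVec]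

lemma householder_ortho {w : ι → ℝ} (hw : w ⬝ᵥ w ≠ 0) :
    (householder w)ᵀ * householder w = 1 := by
  have e : vecMulVec w w * vecMulVec w w = (w ⬝ᵥ w) • vecMulVec w w := by
    rw [vecMulVec_mul_vecMulVec, vecMulVec_smul]
  rw [householder_transpose, householder, sub_mul, mul_sub, mul_sub, one_mul, one_mul, mul_one,
    Matrix.smul_mul, Matrix.mul_smul, e, smul_smul, smul_smul]
  rw [show 2 / (w ⬝ᵥ w) * (2 / (w ⬝ᵥ w)) * (w ⬝ᵥ w) = 2 / (w ⬝ᵥ w) + 2 / (w ⬝ᵥ w) by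
    field_simp; norm_num, add_smul]
  abel

lemma trace_vecMulVec_mul (v w : ι → ℝ) (N : Matrix ι ι ℝ) :
    (vecMulVec v w * N).trace = w ⬝ᵥ N *ᵥ v := by
  rw [vecMulVec_mul, trace_vecMulVec, dotProduct_mulVec, dotProduct_comm]

lemma trace_householder_mul (w : ι → ℝ) (N : Matrix ι ι ℝ) :
    (householder w * N).trace = N.trace - 2 / (w ⬝ᵥ w) * (w ⬝ᵥ N *ᵥ w) := by
  rw [householder, sub_mul, one_mul, trace_sub, Matrix.smul_mul, trace_smul, trace_vecMulVec_mul,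
    smul_eq_mul]

lemma isPolar_of_isMax_trace {X R : Matrix ι ι ℝ} (hR : Rᵀ * R = 1)
    (hmax : ∀ U : Matrix ι ι ℝ, Uᵀ * U = 1 → (Uᵀ * X).trace ≤ (Rᵀ * X).trace) :
    IsPolar X R := by
  set N := Rᵀ * X with hN
  have key : ∀ U : Matrix ι ι ℝ, Uᵀ * U = 1 → (U * N).trace ≤ N.trace := fun U hU => by
    have := hmax (R * Uᵀ) (ortho_mul hR (ortho_transpose hU))
    rwa [transpose_mul, transpose_transpose, Matrix.mul_assoc] at this
  refine ⟨hR, ?_, fun u => ?_⟩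
  · -- a product of two reflections is a plane rotation; compare the terms linear in the angle
    rw [← hN]
    ext j i
    rw [transpose_apply]
    rcases eq_or_ne i j with rfl | hij
    · rfl
    have hlin : ∀ t : ℝ, t * (N j i - N i j) ≤ t ^ 2 * (N i i + N j j) := by
      intro t
      set v : ι → ℝ := Pi.single i 1 with hv
      set w : ι → ℝ := Pi.single i 1 + t • Pi.single j 1 with hw
      have hvv : v ⬝ᵥ v = 1 := by simp [hv]
      have hww : w ⬝ᵥ w = 1 + t ^ 2 := by
        simp [hw, hij, hij.symm, dotProduct_add]; ring
      have hvw : w ⬝ᵥ v = 1 := by simp [hv, hw, hij.symm]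
      have hvNv : v ⬝ᵥ N *ᵥ v = N i i := by simp [hv]
      have hwNv : w ⬝ᵥ N *ᵥ v = N i i + t * N j i := by simp [hv, hw, add_dotProduct]
      have hwNw : w ⬝ᵥ N *ᵥ w = N i i + t * (N i j + N j i) + t ^ 2 * N j j := by
        simp [hw, add_dotProduct, mulVec_add, mulVec_smul]; ring
      have hp : 0 < 1 + t ^ 2 := by positivity
      have h1 := key (householder v * householder w)
        (ortho_mul (householder_ortho (by rw [hvv]; norm_num))
          (householder_ortho (by rw [hww]; exact hp.ne')))
      have h2 : v ⬝ᵥ (householder w * N) *ᵥ v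
          = N i i - 2 / (1 + t ^ 2) * (N i i + t * N j i) := by
        rw [householder, sub_mul, one_mul, sub_mulVec, dotProduct_sub, hvNv, hww, Matrix.smul_mul,
          smul_mulVec, dotProduct_smul, ← mulVec_mulVec, vecMulVec_mulVec, hwNv]
        simp [dotProduct_comm v w, hvw]
      rw [Matrix.mul_assoc, trace_householder_mul, trace_householder_mul, hvv, hww, hwNw, h2] at h1
      have h3 : 2 / (1 + t ^ 2) * (2 * (N i i + t * N j i)
          - (N i i + t * (N i j + N j i) + t ^ 2 * N j j) - (1 + t ^ 2) * N i i) ≤ 0 := by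
        have : 2 / (1 + t ^ 2) * ((1 + t ^ 2) * N i i) = 2 * N i i := by field_simp
        rw [mul_sub, mul_sub, this]
        linarith
      have h4 := nonpos_of_mul_nonpos_right h3 (by positivity)
      linarith
    have := hlin ((N j i - N i j) / (|N i i + N j j| + 1))
    by_contra hne
    have hx : 0 < (N j i - N i j) ^ 2 := by
      have : N j i - N i j ≠ 0 := fun h => hne (by linarith)
      positivity
    set c := |N i i + N j j| + 1 with hc
    have hc0 : 0 < c := by positivity
    have hsc : N i i + N j j < c := by linarith [le_abs_self (N i i + N j j)]
    rw [div_pow, div_mul_eq_mul_div, div_mul_eq_mul_div,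
      div_le_div_iff₀ hc0 (by positivity)] at this
    have h2 : (N j i - N i j) ^ 2 * c * (c - (N i i + N j j)) ≤ 0 := by nlinarith
    have h3 : 0 < (N j i - N i j) ^ 2 * c * (c - (N i i + N j j)) :=
      mul_pos (mul_pos hx hc0) (by linarith)
    linarith
  · rcases eq_or_ne u 0 with rfl | hu
    · simp
    have huu : 0 < u ⬝ᵥ u := by rw [← l2_sq]; exact pow_pos (l2_pos hu) 2
    have h1 := key (householder u) (householder_ortho huu.ne')
    rw [trace_householder_mul] at h1
    have h2 : 0 ≤ 2 / (u ⬝ᵥ u) * (u ⬝ᵥ N *ᵥ u) := by linarith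
    exact nonneg_of_mul_nonneg_right h2 (by positivity)

lemma exists_isPolar (X : Matrix ι ι ℝ) : ∃ R, IsPolar X R := by
  obtain ⟨R, hR, hmax⟩ := exists_isMax_trace X
  exact ⟨R, isPolar_of_isMax_trace hR hmax⟩

lemma isProj_iff_isPolar {d : ℕ} {X R : Matrix (Fin d) (Fin d) ℝ} :
    IsProj X R ↔ IsPolar X R := by
  constructor
  · rintro ⟨hR, hmin⟩
    rw [mem_orthogonalGroup_iff_transpose] at hR
    refine isPolar_of_isMax_trace hR fun U hU => ?_
    have := hmin U (mem_orthogonalGroup_iff_transpose.2 hU)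
    rw [frob_sub_sq hR, frob_sub_sq hU] at this
    linarith
  · intro h
    refine ⟨mem_orthogonalGroup_iff_transpose.2 h.ortho, fun U hU => ?_⟩
    rw [mem_orthogonalGroup_iff_transpose] at hU
    have := h.trace_le hU
    rw [frob_sub_sq h.ortho, frob_sub_sq hU]
    linarith

/-- If `X = H + E` with `H` positive definite, optimality of the polar factor `R` against the
competitor `1` bounds `R - 1` by `E`. -/
lemma IsPolar.frob_sub_one_le {H E R : Matrix ι ι ℝ} (hR : IsPolar (H + E) R) (hH : Hᵀ = H)
    {h : ℝ} (hpos : 0 < h) (hlow : ∀ u, h * l2 u ^ 2 ≤ u ⬝ᵥ H *ᵥ u) :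
    frob (R - 1) ≤ 2 * frob E / h := by
  have h1 := hR.trace_le (U := 1) (by simp)
  have h2 := trace_sub_trace_ortho hR.ortho hH
  have h3 := le_trace_mul_mul_transpose (R - 1) hlow
  have h4 := trace_transpose_mul_le (R - 1) E
  rw [transpose_one, Matrix.one_mul, Matrix.mul_add, trace_add, trace_add] at h1
  rw [transpose_sub, transpose_one, sub_mul, one_mul, trace_sub] at h4
  rw [le_div_iff₀ hpos]
  rcases (frob_nonneg (R - 1)).eq_or_lt with h0 | h0
  · rw [← h0]; have := frob_nonneg E; linarith
  · have : frob (R - 1) * (frob (R - 1) * h) ≤ frob (R - 1) * (2 * frob E) := by nlinarith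
    exact le_of_mul_le_mul_left this h0

/-- A sharper form of `IsPolar.frob_sub_one_le` for `H = B Bᵀ` and `E = B G`: the bound involves
the smallest singular value of `B` only to the first power. -/
lemma IsPolar.frob_sub_one_le_of_gram {B : Matrix ι κ ℝ} {G : Matrix κ ι ℝ} {R : Matrix ι ι ℝ}
    (hR : IsPolar (B * Bᵀ + B * G) R) {s : ℝ} (hs : 0 < s)
    (hlow : ∀ u, s * l2 u ≤ l2 (Bᵀ *ᵥ u)) : frob (R - 1) ≤ 2 * frob G / s := by
  have hH : (B * Bᵀ)ᵀ = B * Bᵀ := by rw [transpose_mul, transpose_transpose]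
  have h1 := hR.trace_le (U := 1) (by simp)
  have h2 := trace_sub_trace_ortho hR.ortho hH
  have h3 : ((R - 1) * (B * Bᵀ) * (R - 1)ᵀ).trace = frob ((R - 1) * B) ^ 2 := by
    rw [← frob_transpose, frob_sq_eq_trace, transpose_transpose, transpose_mul]
    simp only [Matrix.mul_assoc]
  have h4 : ((R - 1)ᵀ * (B * G)).trace ≤ frob ((R - 1) * B) * frob G := by
    -- `(R - 1)ᵀ = -Rᵀ (R - 1)`, so `‖(R - 1)ᵀ B‖_F = ‖(R - 1) B‖_F`
    have e : (R - 1)ᵀ = -(Rᵀ * (R - 1)) := by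
      rw [mul_sub, hR.ortho, transpose_sub, transpose_one, mul_one, neg_sub]
    have := trace_transpose_mul_le (((R - 1)ᵀ * B)ᵀ) G
    rw [transpose_transpose, frob_transpose] at this
    rw [← Matrix.mul_assoc]
    refine this.trans (le_of_eq ?_)
    rw [e, Matrix.neg_mul, frob_neg, Matrix.mul_assoc, frob_ortho_mul (ortho_transpose hR.ortho)]
  have h5 : s * frob (R - 1) ≤ frob ((R - 1) * B) := by
    refine le_of_sq_le_sq ?_ (frob_nonneg _)
    rw [← h3, mul_pow]
    refine le_trace_mul_mul_transpose _ fun u => ?_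
    rw [← mulVec_mulVec, dotProduct_mulVec_comm, ← l2_sq, ← mul_pow]
    exact pow_le_pow_left₀ (mul_nonneg hs.le (l2_nonneg _)) (hlow u) 2
  rw [transpose_one, Matrix.one_mul, Matrix.mul_add, trace_add, trace_add] at h1
  rw [transpose_sub, transpose_one, sub_mul, one_mul, trace_sub] at h4
  rw [le_div_iff₀ hs]
  rcases (frob_nonneg ((R - 1) * B)).eq_or_lt with h0 | h0
  · have := frob_nonneg G; nlinarith
  · have : frob ((R - 1) * B) * frob ((R - 1) * B) ≤ frob ((R - 1) * B) * (2 * frob G) := by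
      nlinarith
    have := le_of_mul_le_mul_left this h0
    linarith

/-- The polar factor is unique when the positive semidefinite factor is positive definite. -/
lemma IsPolar.unique {X R R' : Matrix ι ι ℝ} (h : IsPolar X R) (h' : IsPolar X R') {k : ℝ}
    (hk : 0 < k) (hlow : ∀ u, k * l2 u ^ 2 ≤ u ⬝ᵥ (Rᵀ * X) *ᵥ u) : R' = R := by
  have h1 := h'.mul_left (ortho_transpose h.ortho)
  rw [← add_zero (Rᵀ * X)] at h1
  have h2 := h1.frob_sub_one_le h.symm hk hlow
  rw [frob_zero, mul_zero, zero_div] at h2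
  have h3 := frob_eq_zero.1 (le_antisymm h2 (frob_nonneg _))
  have h4 : R * (Rᵀ * R') = R := by rw [sub_eq_zero.1 h3, Matrix.mul_one]
  rwa [← Matrix.mul_assoc, mul_eq_one_comm.1 h.ortho, Matrix.one_mul] at h4

/-- The least eigenvalue of a symmetric matrix, with an eigenvector. -/
lemma exists_min_eigenvector [Nonempty ι] {K : Matrix ι ι ℝ} (hK : Kᵀ = K) :
    ∃ (c : ℝ) (v : ι → ℝ), v ≠ 0 ∧ K *ᵥ v = c • v ∧ ∀ u, c * l2 u ^ 2 ≤ u ⬝ᵥ K *ᵥ u := by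
  have hH : K.IsHermitian := by
    rw [IsHermitian, conjTranspose_eq_transpose_of_trivial, hK]
  obtain ⟨i, hi⟩ := Finite.exists_min hH.eigenvalues
  refine ⟨hH.eigenvalues i, hH.eigenvectorBasis i, ?_, hH.mulVec_eigenvectorBasis i, fun u => ?_⟩
  · intro h
    have := hH.eigenvectorBasis.orthonormal.ne_zero i
    exact this (by ext j; exact congrFun h j)
  · have hin : ∀ x y : EuclideanSpace ℝ ι, inner ℝ x y = x.ofLp ⬝ᵥ y.ofLp := fun x y => by
      rw [EuclideanSpace.inner_eq_star_dotProduct, dotProduct_comm]; rfl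
    have e1 := hH.eigenvectorBasis.sum_inner_mul_inner (WithLp.toLp 2 u) (WithLp.toLp 2 u)
    have e2 := hH.eigenvectorBasis.sum_inner_mul_inner (WithLp.toLp 2 u) (WithLp.toLp 2 (K *ᵥ u))
    simp only [hin] at e1 e2
    rw [l2_sq, ← e1, ← e2, Finset.mul_sum]
    refine Finset.sum_le_sum fun j _ => ?_
    rw [dotProduct_mulVec_comm, hK, hH.mulVec_eigenvectorBasis, smul_dotProduct, smul_eq_mul,
      dotProduct_comm (hH.eigenvectorBasis j).ofLp u]
    nlinarith [mul_le_mul_of_nonneg_right (hi j)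
      (mul_self_nonneg (u ⬝ᵥ (hH.eigenvectorBasis j).ofLp))]

/-- A lower bound for the singular values of `X` is one for the eigenvalues of its positive
semidefinite factor: test with an eigenvector of the least eigenvalue. -/
lemma IsPolar.le_of_l2_le {X R : Matrix ι ι ℝ} (h : IsPolar X R) {k : ℝ}
    (hlow : ∀ u, k * l2 u ≤ l2 (X *ᵥ u)) (u : ι → ℝ) :
    k * l2 u ^ 2 ≤ u ⬝ᵥ (Rᵀ * X) *ᵥ u := by
  rcases isEmpty_or_nonempty ι with hι | hι
  · simp [l2_sq, dotProduct]
  obtain ⟨c, v, hv, hKv, hmin⟩ := exists_min_eigenvector h.symm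
  have hc : 0 ≤ c := by
    have := h.nonneg v
    rw [hKv, dotProduct_smul, ← l2_sq, smul_eq_mul] at this
    exact nonneg_of_mul_nonneg_left this (pow_pos (l2_pos hv) 2)
  have h1 := hlow v
  have h2 : l2 (X *ᵥ v) = c * l2 v := by
    rw [← l2_ortho_mulVec (ortho_transpose h.ortho), mulVec_mulVec, hKv, l2_smul, abs_of_nonneg hc]
  rw [h2] at h1
  have h3 := le_of_mul_le_mul_right h1 (l2_pos hv)
  exact (mul_le_mul_of_nonneg_right h3 (sq_nonneg _)).trans (hmin u)

end

section
variable {ι κ : Type*} [Fintype ι] [Fintype κ] [DecidableEq ι] [DecidableEq κ]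

/-- An orthogonal matrix rotates some plane (or fixes some axis up to sign) by the angle at which
its distance from the identity is attained. -/
lemma exists_rotation_plane [Nonempty ι] {R : Matrix ι ι ℝ} (hR : Rᵀ * R = 1) :
    ∃ (c s : ℝ) (p q : ι → ℝ), c ^ 2 + s ^ 2 = 1 ∧ p ≠ 0 ∧ R *ᵥ p = c • p - s • q ∧
      R *ᵥ q = s • p + c • q ∧ ∀ x, l2 ((R - 1) *ᵥ x) ^ 2 ≤ (2 - 2 * c) * l2 x ^ 2 := by
  obtain ⟨c', v, hv, hKv, hmin⟩ := exists_min_eigenvector (K := R + Rᵀ)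
    (by rw [transpose_add, transpose_transpose, add_comm])
  obtain ⟨c, rfl⟩ : ∃ c, c' = 2 * c := ⟨c' / 2, by ring⟩
  have hRR : R * Rᵀ = 1 := mul_eq_one_comm.1 hR
  set w := R *ᵥ v - c • v with hw
  have hRv : R *ᵥ v = c • v + w := by rw [hw]; abel
  have hRRv : R *ᵥ (R *ᵥ v) = (2 * c) • (R *ᵥ v) - v := by
    have := congrArg (fun x => R *ᵥ x) hKv
    simp only [add_mulVec, mulVec_add, mulVec_mulVec, hRR, one_mulVec, mulVec_smul] at this ⊢
    rw [← this]; abel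
  have hRw : R *ᵥ w = c • w - (1 - c ^ 2) • v := by
    have : R *ᵥ w = R *ᵥ (R *ᵥ v) - c • R *ᵥ v := by rw [hw, mulVec_sub, mulVec_smul]
    rw [this, hRRv, hRv]
    ext i; simp; ring
  have hvRv : v ⬝ᵥ R *ᵥ v = c * l2 v ^ 2 := by
    have h1 : v ⬝ᵥ (R + Rᵀ) *ᵥ v = 2 * c * l2 v ^ 2 := by
      rw [hKv, dotProduct_smul, ← l2_sq, smul_eq_mul]
    rw [add_mulVec, dotProduct_add, dotProduct_mulVec_comm Rᵀ, transpose_transpose,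
      dotProduct_comm (R *ᵥ v)] at h1
    linarith
  have hww : l2 w ^ 2 = (1 - c ^ 2) * l2 v ^ 2 := by
    have h1 : R *ᵥ v ⬝ᵥ R *ᵥ v = v ⬝ᵥ v := by rw [← l2_sq, ← l2_sq, l2_ortho_mulVec hR]
    rw [l2_sq, hw, sub_dotProduct, dotProduct_sub, dotProduct_sub, h1]
    simp only [smul_dotProduct, dotProduct_smul, smul_eq_mul, dotProduct_comm (R *ᵥ v) v, hvRv,
      ← l2_sq]
    ring
  have hc : 0 ≤ 1 - c ^ 2 := by
    by_contra hneg
    push Not at hneg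
    have := mul_neg_of_neg_of_pos hneg (pow_pos (l2_pos hv) 2)
    rw [← hww] at this
    linarith [sq_nonneg (l2 w)]
  have hnorm : ∀ x, l2 ((R - 1) *ᵥ x) ^ 2 ≤ (2 - 2 * c) * l2 x ^ 2 := fun x => by
    have h1 := hmin x
    rw [add_mulVec, dotProduct_add, dotProduct_mulVec_comm Rᵀ, transpose_transpose,
      dotProduct_comm (R *ᵥ x)] at h1
    have h2 : R *ᵥ x ⬝ᵥ R *ᵥ x = x ⬝ᵥ x := by rw [← l2_sq, ← l2_sq, l2_ortho_mulVec hR]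
    rw [l2_sq, sub_mulVec, one_mulVec, sub_dotProduct, dotProduct_sub, dotProduct_sub, h2,
      dotProduct_comm (R *ᵥ x) x, ← l2_sq]
    linarith
  set s := √(1 - c ^ 2) with hs
  have hs2 : s ^ 2 = 1 - c ^ 2 := Real.sq_sqrt hc
  rcases eq_or_ne s 0 with h0 | h0
  · have hw0 : w = 0 := by
      rw [← hs2, h0] at hww
      exact l2_eq_zero.1 (pow_eq_zero_iff two_ne_zero |>.1 (by rw [hww]; ring))
    refine ⟨c, 0, v, 0, by rw [h0] at hs2; linarith, hv, ?_, by simp, hnorm⟩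
    rw [hRv, hw0]; simp
  · refine ⟨c, s, v, -(s⁻¹ • w), by linarith, hv, ?_, ?_, hnorm⟩
    · rw [hRv, smul_neg, smul_smul, mul_inv_cancel₀ h0, one_smul, sub_neg_eq_add]
    · rw [mulVec_neg, mulVec_smul, hRw, ← hs2]
      ext i; simp; field_simp; ring

/-- The operator-norm counterpart of `IsPolar.frob_sub_one_le`.  Comparing the quadratic forms of
`X = H + E` and of `Rᵀ X` on the plane that `R` rotates most gives a bound by the size of `E`
*relative* to `H`, which is much better than `‖E‖` over the least eigenvalue of `H` when `E` is
small in the directions in which `H` is. -/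
lemma IsPolar.norm_sub_one_le [Nonempty ι] {H E R : Matrix ι ι ℝ} (hR : IsPolar (H + E) R)
    (hH : Hᵀ = H) (hpos : ∀ u, u ≠ 0 → 0 < u ⬝ᵥ H *ᵥ u) {β : ℝ}
    (hE : ∀ u, l2 u * l2 (E *ᵥ u) ≤ β * (u ⬝ᵥ H *ᵥ u)) : ‖R - 1‖ ≤ 2 * β := by
  obtain ⟨c, s, p, q, hcs, hp, hRp, hRq, hnorm⟩ := exists_rotation_plane hR.ortho
  have hc : 0 ≤ 2 - 2 * c := by nlinarith [sq_nonneg s, sq_nonneg (c - 1)]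
  set μ := √(2 - 2 * c) with hμ
  have hμ0 : 0 ≤ μ := Real.sqrt_nonneg _
  have hμ2 : μ ^ 2 = 2 - 2 * c := Real.sq_sqrt hc
  have hl2 : ∀ x, l2 ((R - 1) *ᵥ x) ≤ μ * l2 x := fun x =>
    le_of_sq_le_sq (by rw [mul_pow, hμ2]; exact hnorm x) (mul_nonneg hμ0 (l2_nonneg x))
  have hRle : ‖R - 1‖ ≤ μ := norm_le_of_l2 hμ0 hl2
  set K := Rᵀ * (H + E) with hK
  -- `c (Kp·p + Kq·q) = Xp·p + Xq·q` and `Kp·p + Kq·q = Xp·Rp + Xq·Rq`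
  have hKx : ∀ x y, y ⬝ᵥ K *ᵥ x = (R *ᵥ y) ⬝ᵥ (H + E) *ᵥ x := fun x y => by
    rw [hK, dotProduct_transpose_mul_mulVec]
  have hKsymm := dotProduct_mulVec_symm hR.symm
  have e1 := hKx p p
  have e2 := hKx q q
  have e3 : c * (p ⬝ᵥ K *ᵥ p + q ⬝ᵥ K *ᵥ q)
      = p ⬝ᵥ (H + E) *ᵥ p + q ⬝ᵥ (H + E) *ᵥ q := by
    have hp' : R *ᵥ (c • p + s • q) = p := by
      rw [mulVec_add, mulVec_smul, mulVec_smul, hRp, hRq]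
      ext i; simp; linear_combination p i * hcs
    have hq' : R *ᵥ (c • q - s • p) = q := by
      rw [mulVec_sub, mulVec_smul, mulVec_smul, hRp, hRq]
      ext i; simp; linear_combination q i * hcs
    have a1 := hKx p (c • p + s • q)
    have a2 := hKx q (c • q - s • p)
    rw [hp'] at a1
    rw [hq'] at a2
    rw [← a1, ← a2]
    simp only [add_dotProduct, sub_dotProduct, smul_dotProduct, smul_eq_mul]
    rw [hKsymm q p]; ring
  have hHs := dotProduct_mulVec_symm hH q p
  have hEp : ∀ x, ((R - 1) *ᵥ x) ⬝ᵥ E *ᵥ x ≤ μ * (β * (x ⬝ᵥ H *ᵥ x)) := fun x => by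
    refine (dotProduct_le _ _).trans ((mul_le_mul_of_nonneg_right (hl2 x) (l2_nonneg _)).trans ?_)
    rw [mul_assoc]
    exact mul_le_mul_of_nonneg_left (hE x) hμ0
  have hEp1 := hEp p
  have hEq1 := hEp q
  have hk : 0 ≤ p ⬝ᵥ K *ᵥ p + q ⬝ᵥ K *ᵥ q := add_nonneg (hR.nonneg p) (hR.nonneg q)
  have hhp := hpos p hp
  have hhq : 0 ≤ q ⬝ᵥ H *ᵥ q := by
    rcases eq_or_ne q 0 with rfl | hq
    · simp
    · exact (hpos q hq).le
  set hsum := p ⬝ᵥ H *ᵥ p + q ⬝ᵥ H *ᵥ q with hhsum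
  have hs0 : 0 < hsum := by linarith
  have key : (1 - c) * hsum ≤ μ * β * hsum := by
    rw [sub_mulVec, one_mulVec, sub_dotProduct] at hEp1 hEq1
    simp only [add_mulVec, dotProduct_add] at e1 e2 e3
    have f1 : R *ᵥ p ⬝ᵥ H *ᵥ p = c * (p ⬝ᵥ H *ᵥ p) - s * (q ⬝ᵥ H *ᵥ p) := by
      rw [hRp]; simp [sub_dotProduct]
    have f2 : R *ᵥ q ⬝ᵥ H *ᵥ q = s * (p ⬝ᵥ H *ᵥ q) + c * (q ⬝ᵥ H *ᵥ q) := by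
      rw [hRq]; simp [add_dotProduct]
    rw [f1, hHs] at e1
    rw [f2] at e2
    have hck : 0 ≤ (1 - c) * (p ⬝ᵥ K *ᵥ p + q ⬝ᵥ K *ᵥ q) := mul_nonneg (by linarith) hk
    simp only [hhsum]
    linarith
  have h1 : 1 - c ≤ μ * β := le_of_mul_le_mul_right key hs0
  refine hRle.trans ?_
  rcases hμ0.eq_or_lt with h0 | h0
  · rw [← h0]
    have := (mul_nonneg (l2_nonneg p) (l2_nonneg (E *ᵥ p))).trans (hE p)
    have := nonneg_of_mul_nonneg_left this hhp
    linarith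
  · have : μ * μ ≤ μ * (2 * β) := by nlinarith
    exact le_of_mul_le_mul_left this h0

/-! ### The smallest singular value -/

/-- `σ_min(A)` bounds `Aᵀ` from below: expand `u` in an eigenbasis of `A Aᵀ`. -/
lemma sigmaMin_mul_l2_le {d m : ℕ} (hd : 0 < d) (A : Matrix (Fin d) (Fin m) ℝ) (u : Fin d → ℝ) :
    sigmaMin A * l2 u ≤ l2 (Aᵀ *ᵥ u) := by
  set T := Matrix.toEuclideanLin A.transpose with hT
  have hn : Module.finrank ℝ (EuclideanSpace ℝ (Fin d)) = d := by simp
  have hσ : 0 ≤ sigmaMin A := LinearMap.singularValues_nonneg _ _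
  refine le_of_sq_le_sq ?_ (l2_nonneg _)
  set x : EuclideanSpace ℝ (Fin d) := WithLp.toLp 2 u
  have h1 : l2 (Aᵀ *ᵥ u) = ‖T x‖ := rfl
  have hS := T.isSymmetric_adjoint_comp_self
  have e1 := (hS.eigenvectorBasis hn).sum_inner_mul_inner x x
  have e2 := (hS.eigenvectorBasis hn).sum_inner_mul_inner x ((LinearMap.adjoint T ∘ₗ T) x)
  have e3 : inner ℝ x ((LinearMap.adjoint T ∘ₗ T) x) = ‖T x‖ ^ 2 := by
    rw [LinearMap.comp_apply, LinearMap.adjoint_inner_right, real_inner_self_eq_norm_sq]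
  have e4 : inner ℝ x x = l2 u ^ 2 := real_inner_self_eq_norm_sq x
  rw [h1, mul_pow, ← e3, ← e2, ← e4, ← e1, Finset.mul_sum]
  refine Finset.sum_le_sum fun i _ => ?_
  have e5 : inner ℝ (hS.eigenvectorBasis hn i) ((LinearMap.adjoint T ∘ₗ T) x)
      = T.singularValues i ^ 2 * inner ℝ (hS.eigenvectorBasis hn i) x := by
    rw [← hS, hS.apply_eigenvectorBasis, inner_smul_left, T.sq_singularValues_fin hn]
    simp
  have e6 : sigmaMin A ^ 2 ≤ T.singularValues i ^ 2 :=
    pow_le_pow_left₀ hσ (T.singularValues_antitone (by have := i.2; omega)) 2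
  rw [e5, real_inner_comm x]
  nlinarith [mul_le_mul_of_nonneg_right e6
    (mul_self_nonneg (inner ℝ x (hS.eigenvectorBasis hn i)))]

end

section
variable {ι κ : Type*} [Fintype ι] [Fintype κ] [DecidableEq ι] [DecidableEq κ]
variable {n : ℕ}

/-! ### Means over the blocks -/

/-- The arithmetic mean of a family of `n` vectors. -/
def mean {E : Type*} [AddCommGroup E] [Module ℝ E] (X : Fin n → E) : E := (n : ℝ)⁻¹ • ∑ i, X i

section
variable {E F : Type*} [AddCommGroup E] [Module ℝ E] [AddCommGroup F] [Module ℝ F]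

lemma map_mean (f : E →ₗ[ℝ] F) (X : Fin n → E) : f (mean X) = mean fun i => f (X i) := by
  simp [mean, map_smul, map_sum]

lemma mean_add (X Y : Fin n → E) : mean (fun i => X i + Y i) = mean X + mean Y := by
  simp [mean, Finset.sum_add_distrib]

lemma mean_sub (X Y : Fin n → E) : mean (fun i => X i - Y i) = mean X - mean Y := by
  simp [mean, Finset.sum_sub_distrib, smul_sub]

lemma mean_const (hn : 0 < n) (x : E) : mean (fun _ : Fin n => x) = x := by
  have : (n : ℝ) ≠ 0 := by positivity
  simp [mean, ← Nat.cast_smul_eq_nsmul ℝ, smul_smul, this]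

lemma natCast_smul_mean (hn : 0 < n) (X : Fin n → E) : (n : ℝ) • mean X = ∑ i, X i := by
  have : (n : ℝ) ≠ 0 := by positivity
  simp [mean, smul_smul, this]

end

lemma mean_mono {a b : Fin n → ℝ} (h : ∀ i, a i ≤ b i) : mean a ≤ mean b :=
  mul_le_mul_of_nonneg_left (Finset.sum_le_sum fun i _ => h i) (by positivity)

lemma mean_nonneg {a : Fin n → ℝ} (h : ∀ i, 0 ≤ a i) : 0 ≤ mean a :=
  mul_nonneg (by positivity) (Finset.sum_nonneg fun i _ => h i)

lemma mean_const_mul (c : ℝ) (a : Fin n → ℝ) : mean (fun i => c * a i) = c * mean a :=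
  (map_mean (LinearMap.mulLeft ℝ c) a).symm

lemma mean_mul_sq_le (a b : Fin n → ℝ) :
    mean (fun i => a i * b i) ^ 2 ≤ mean (fun i => a i ^ 2) * mean fun i => b i ^ 2 := by
  have := Finset.sum_mul_sq_le_sq_mul_sq Finset.univ a b
  simp only [mean, smul_eq_mul]
  calc ((n : ℝ)⁻¹ * ∑ i, a i * b i) ^ 2 = ((n : ℝ)⁻¹) ^ 2 * (∑ i, a i * b i) ^ 2 := by ring
    _ ≤ ((n : ℝ)⁻¹) ^ 2 * ((∑ i, a i ^ 2) * ∑ i, b i ^ 2) := by gcongr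
    _ = _ := by ring

/-- The Cauchy-Schwarz inequality for means. -/
lemma mean_mul_le {a b : Fin n → ℝ} {s t : ℝ} (hs : 0 ≤ s) (ht : 0 ≤ t)
    (ha : mean (fun i => a i ^ 2) ≤ s ^ 2) (hb : mean (fun i => b i ^ 2) ≤ t ^ 2) :
    mean (fun i => a i * b i) ≤ s * t := by
  refine le_of_sq_le_sq ((mean_mul_sq_le a b).trans ?_) (mul_nonneg hs ht)
  rw [mul_pow]
  exact mul_le_mul ha hb (mean_nonneg fun i => sq_nonneg _) (sq_nonneg _)

lemma mean_le_of_mean_sq_le (hn : 0 < n) {a : Fin n → ℝ} {s : ℝ} (hs : 0 ≤ s)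
    (ha : mean (fun i => a i ^ 2) ≤ s ^ 2) : mean a ≤ s := by
  have := mean_mul_le (b := fun _ => 1) hs zero_le_one ha (by simp [mean_const hn])
  simpa using this

/-- The triangle inequality for the root mean square, one summand being constant. -/
lemma mean_add_sq_le (hn : 0 < n) {a : Fin n → ℝ} {s c : ℝ} (hs : 0 ≤ s) (hc : 0 ≤ c)
    (ha : mean (fun i => a i ^ 2) ≤ s ^ 2) : mean (fun i => (a i + c) ^ 2) ≤ (s + c) ^ 2 := by
  have h1 : mean (fun i => (a i + c) ^ 2) = mean (fun i => a i ^ 2) + 2 * c * mean a + c ^ 2 := by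
    calc mean (fun i => (a i + c) ^ 2)
        = mean (fun i => a i ^ 2 + 2 * c * a i + c ^ 2) := by congr 1; ext i; ring
      _ = _ := by rw [mean_add, mean_add, mean_const_mul, mean_const hn]
  have := mean_le_of_mean_sq_le hn hs ha
  rw [h1]
  nlinarith

lemma norm_mean_le {E : Type*} [NormedAddCommGroup E] [NormedSpace ℝ E] (X : Fin n → E) :
    ‖mean X‖ ≤ mean fun i => ‖X i‖ := by
  rw [mean, norm_smul, Real.norm_of_nonneg (by positivity)]
  exact mul_le_mul_of_nonneg_left (norm_sum_le _ _) (by positivity)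

lemma frob_mean_le (X : Fin n → Matrix ι κ ℝ) : frob (mean X) ≤ mean fun i => frob (X i) := by
  rw [mean, frob_smul, abs_of_nonneg (by positivity)]
  exact mul_le_mul_of_nonneg_left (frob_sum_le _ _) (by positivity)

lemma transpose_mean (X : Fin n → Matrix ι κ ℝ) : (mean X)ᵀ = mean fun i => (X i)ᵀ := by
  simp [mean, transpose_sum]

lemma mean_mul {l : Type*} (X : Fin n → Matrix ι κ ℝ) (Y : Matrix κ l ℝ) :
    mean X * Y = mean fun i => X i * Y := by
  simp [mean, Matrix.sum_mul]

lemma mul_mean {l : Type*} [Fintype l] (Y : Matrix l ι ℝ) (X : Fin n → Matrix ι κ ℝ) :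
    Y * mean X = mean fun i => Y * X i := by
  simp [mean, Matrix.mul_sum]

lemma mean_mulVec (X : Fin n → Matrix ι κ ℝ) (u : κ → ℝ) :
    mean X *ᵥ u = mean fun i => X i *ᵥ u := by
  simp [mean, smul_mulVec, sum_mulVec]

lemma dotProduct_mean (u : ι → ℝ) (v : Fin n → ι → ℝ) :
    u ⬝ᵥ mean v = mean fun i => u ⬝ᵥ v i := by
  simp [mean, dotProduct_sum]

lemma trace_mean (X : Fin n → Matrix ι ι ℝ) : (mean X).trace = mean fun i => (X i).trace := by
  simp [mean, trace_sum]

lemma norm_mean_sub_le (hn : 0 < n) {S : Fin n → Matrix ι κ ℝ} {Q : Matrix ι κ ℝ} {t : ℝ}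
    (ht : 0 ≤ t) (h : mean (fun i => ‖S i - Q‖ ^ 2) ≤ t ^ 2) : ‖mean S - Q‖ ≤ t := by
  have : mean S - Q = mean fun i => S i - Q := by rw [mean_sub, mean_const hn]
  rw [this]
  exact (norm_mean_le _).trans (mean_le_of_mean_sq_le hn ht h)

/-! ### One step of the power method -/

/-- `n⁻¹ Dᵀ S`, in terms of the blocks `A i` of `D` and `S i` of `S`.  The power method replaces
`S i` by a polar factor of `A i * corr A S`. -/
def corr (A : Fin n → Matrix ι κ ℝ) (S : Fin n → Matrix ι ι ℝ) : Matrix κ ι ℝ :=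
  mean fun j => (A j)ᵀ * S j

lemma corr_mul (A : Fin n → Matrix ι κ ℝ) (S : Fin n → Matrix ι ι ℝ) (Q : Matrix ι ι ℝ) :
    corr A (fun i => S i * Q) = corr A S * Q := by
  simp only [corr, mean_mul, Matrix.mul_assoc]

lemma trace_corr_transpose_mul (A : Fin n → Matrix ι κ ℝ) (S : Fin n → Matrix ι ι ℝ)
    (M : Matrix κ ι ℝ) :
    ((corr A S)ᵀ * M).trace = mean fun j => ((S j)ᵀ * (A j * M)).trace := by
  simp only [corr, transpose_mean, mean_mul, trace_mean, transpose_mul, transpose_transpose,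
    Matrix.mul_assoc]

lemma dotProduct_corr_mulVec (A : Fin n → Matrix ι κ ℝ) (S : Fin n → Matrix ι ι ℝ) (v : κ → ℝ)
    (u : ι → ℝ) : v ⬝ᵥ corr A S *ᵥ u = mean fun j => (A j *ᵥ v) ⬝ᵥ S j *ᵥ u := by
  rw [corr, mean_mulVec, dotProduct_mean]
  congr 1; ext j
  rw [← mulVec_mulVec, dotProduct_mulVec_comm, transpose_transpose]

lemma norm_corr_sub_le (hn : 0 < n) {A : Matrix ι κ ℝ} {Δ : Fin n → Matrix ι κ ℝ} {δ γ : ℝ}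
    (hΔ : ∀ i, ‖Δ i‖ ≤ δ) {S : Fin n → Matrix ι ι ℝ} (hS : ∀ i, (S i)ᵀ * S i = 1)
    {Q : Matrix ι ι ℝ} (hQ : ‖mean S - Q‖ ≤ γ) :
    ‖corr (fun i => A + Δ i) S - Aᵀ * Q‖ ≤ ‖A‖ * γ + δ := by
  have e : corr (fun i => A + Δ i) S - Aᵀ * Q
      = Aᵀ * (mean S - Q) + mean fun j => (Δ j)ᵀ * S j := by
    simp only [corr, transpose_add, Matrix.add_mul, mean_add, Matrix.mul_sub, mul_mean]
    abel
  rw [e]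
  refine (norm_add_le _ _).trans (add_le_add ?_ ?_)
  · refine (norm_mul_le' _ _).trans ?_
    rw [norm_transpose]
    exact mul_le_mul_of_nonneg_left hQ (norm_nonneg _)
  · refine (norm_mean_le _).trans ((mean_mono fun i => ?_).trans (mean_const hn δ).le)
    refine (norm_mul_le' _ _).trans ?_
    rw [norm_transpose, ← mul_one δ]
    exact mul_le_mul (hΔ i) (norm_ortho_le (hS i)) (norm_nonneg _) ((norm_nonneg _).trans (hΔ i))

/-- A lower bound for `Aᵀ` gives its square as a lower bound for `A Aᵀ`, by Cauchy–Schwarz. -/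
lemma sq_mul_l2_le_of_gram {A : Matrix ι κ ℝ} {s : ℝ} (hs : 0 ≤ s)
    (hA : ∀ u, s * l2 u ≤ l2 (Aᵀ *ᵥ u)) (u : ι → ℝ) : s ^ 2 * l2 u ≤ l2 (A *ᵥ (Aᵀ *ᵥ u)) := by
  rcases (l2_nonneg u).eq_or_lt with h | h
  · rw [← h, mul_zero]; exact l2_nonneg _
  have h1 : l2 (Aᵀ *ᵥ u) ^ 2 ≤ l2 u * l2 (A *ᵥ (Aᵀ *ᵥ u)) := by
    rw [l2_sq, ← dotProduct_mulVec_comm]; exact dotProduct_le _ _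
  have h2 : (s * l2 u) ^ 2 ≤ l2 (Aᵀ *ᵥ u) ^ 2 :=
    pow_le_pow_left₀ (mul_nonneg hs (l2_nonneg _)) (hA u) 2
  have : l2 u * (s ^ 2 * l2 u) ≤ l2 u * l2 (A *ᵥ (Aᵀ *ᵥ u)) := by nlinarith
  exact le_of_mul_le_mul_left this h

/-- `B M` is bounded below when `B` is close to `A` and `M` to `Aᵀ Q`. -/
lemma l2_mul_mulVec_ge {A B : Matrix ι κ ℝ} {M : Matrix κ ι ℝ} {Q : Matrix ι ι ℝ} {s e b : ℝ}
    (hs : 0 ≤ s) (hA : ∀ u, s * l2 u ≤ l2 (Aᵀ *ᵥ u)) (hQ : Qᵀ * Q = 1)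
    (hM : ‖M - Aᵀ * Q‖ ≤ e) (hB : ‖B - A‖ ≤ b) (u : ι → ℝ) :
    (s ^ 2 - ‖A‖ * e - b * (‖A‖ + e)) * l2 u ≤ l2 ((B * M) *ᵥ u) := by
  have h1 : A *ᵥ (Aᵀ *ᵥ (Q *ᵥ u))
      = (B * M) *ᵥ u - (A * (M - Aᵀ * Q) + (B - A) * M) *ᵥ u := by
    simp only [mulVec_mulVec, ← sub_mulVec]
    congr 1
    simp only [Matrix.mul_sub, Matrix.sub_mul]
    abel
  have hMn : ‖M‖ ≤ ‖A‖ + e := by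
    have : M = Aᵀ * Q + (M - Aᵀ * Q) := by abel
    rw [this]
    refine (norm_add_le _ _).trans (add_le_add ?_ hM)
    refine (norm_mul_le' _ _).trans ?_
    rw [norm_transpose]
    exact mul_le_of_le_one_right (norm_nonneg _) (norm_ortho_le hQ)
  have h2 : ‖A * (M - Aᵀ * Q) + (B - A) * M‖ ≤ ‖A‖ * e + b * (‖A‖ + e) := by
    refine (norm_add_le _ _).trans (add_le_add ?_ ?_)
    · exact (norm_mul_le' _ _).trans (mul_le_mul_of_nonneg_left hM (norm_nonneg _))
    · exact (norm_mul_le' _ _).trans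
        (mul_le_mul hB hMn (norm_nonneg _) ((norm_nonneg _).trans hB))
  have h3 := sq_mul_l2_le_of_gram hs hA (Q *ᵥ u)
  rw [l2_ortho_mulVec hQ, h1] at h3
  have h4 := l2_sub_le ((B * M) *ᵥ u) ((A * (M - Aᵀ * Q) + (B - A) * M) *ᵥ u)
  have h5 := (l2_mulVec_le (A * (M - Aᵀ * Q) + (B - A) * M) u).trans
    (mul_le_mul_of_nonneg_right h2 (l2_nonneg u))
  linarith

/-- Perturbation of polar factors in operator norm, relative to the symmetric part `Qᵀ X`. -/
lemma IsPolar.norm_sub_le [Nonempty ι] {X E Q R : Matrix ι ι ℝ} (hQ : IsPolar X Q)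
    (hR : IsPolar (X + E) R) (hpos : ∀ u, u ≠ 0 → 0 < u ⬝ᵥ (Qᵀ * X) *ᵥ u) {β : ℝ}
    (hE : ∀ u, l2 u * l2 (E *ᵥ u) ≤ β * (u ⬝ᵥ (Qᵀ * X) *ᵥ u)) : ‖R - Q‖ ≤ 2 * β := by
  have hQt := ortho_transpose hQ.ortho
  have h1 := hR.mul_left hQt
  rw [mul_add] at h1
  have h2 := h1.norm_sub_one_le hQ.symm hpos (β := β) (fun u => by
    rw [← mulVec_mulVec, l2_ortho_mulVec hQt]; exact hE u)
  have e : R - Q = Q * (Qᵀ * R - 1) := by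
    rw [mul_sub, ← Matrix.mul_assoc, mul_eq_one_comm.1 hQ.ortho, Matrix.one_mul, Matrix.mul_one]
  rw [e]
  exact (norm_mul_le' _ _).trans
    ((mul_le_of_le_one_left (norm_nonneg _) (norm_ortho_le hQ.ortho)).trans h2)

/-- After one step all blocks are close to a common orthogonal matrix, a polar factor of `A M`. -/
lemma norm_step_sub_le [Nonempty ι] {A E : Matrix ι κ ℝ} {M : Matrix κ ι ℝ} {Q R : Matrix ι ι ℝ}
    (hQ : IsPolar (A * M) Q) (hR : IsPolar ((A + E) * M) R) {k δ b : ℝ} (hk : 0 < k)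
    (hlow : ∀ u, k * l2 u ≤ l2 ((A * M) *ᵥ u)) (hE : ‖E‖ ≤ δ) (hM : ‖M‖ ≤ b) :
    ‖R - Q‖ ≤ 2 * (δ * b / k) := by
  rw [Matrix.add_mul] at hR
  have hl := hQ.le_of_l2_le hlow
  refine hQ.norm_sub_le hR (fun u hu => ?_) fun u => ?_
  · exact (mul_pos hk (pow_pos (l2_pos hu) 2)).trans_le (hl u)
  · have hδ : 0 ≤ δ := (norm_nonneg _).trans hE
    have hb : 0 ≤ b := (norm_nonneg _).trans hM
    have h1 : l2 ((E * M) *ᵥ u) ≤ δ * b * l2 u := by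
      refine (l2_mulVec_le _ _).trans (mul_le_mul_of_nonneg_right ?_ (l2_nonneg _))
      exact (norm_mul_le' _ _).trans (mul_le_mul hE hM (norm_nonneg _) hδ)
    calc l2 u * l2 ((E * M) *ᵥ u) ≤ l2 u * (δ * b * l2 u) :=
          mul_le_mul_of_nonneg_left h1 (l2_nonneg _)
      _ = δ * b / k * (k * l2 u ^ 2) := by field_simp
      _ ≤ _ := mul_le_mul_of_nonneg_left (hl u) (by positivity)

/-! ### Existence of a fixed point -/

/-- The families of orthogonal matrices that lie within `τ` of a common orthogonal matrix. -/
def tube (n : ℕ) (ι : Type*) [Fintype ι] [DecidableEq ι] (τ : ℝ) : Set (Fin n → Matrix ι ι ℝ) :=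
  {S | (∀ i, (S i)ᵀ * S i = 1) ∧ ∃ Q : Matrix ι ι ℝ, Qᵀ * Q = 1 ∧ ∀ i, ‖S i - Q‖ ≤ τ}

lemma isCompact_tube (τ : ℝ) : IsCompact (tube n ι τ) := by
  have : ProperSpace (Matrix ι ι ℝ) := FiniteDimensional.proper ℝ _
  have hc : IsCompact {p : (Fin n → Matrix ι ι ℝ) × Matrix ι ι ℝ |
      (∀ i, (p.1 i)ᵀ * p.1 i = 1) ∧ p.2ᵀ * p.2 = 1 ∧ ∀ i, ‖p.1 i - p.2‖ ≤ τ} := by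
    refine Metric.isCompact_of_isClosed_isBounded ?_ ?_
    · simp only [Set.ofPred_and, Set.ofPred_forall]
      refine (isClosed_iInter fun i => isClosed_eq (by fun_prop) continuous_const).inter
        ((isClosed_eq (by fun_prop) continuous_const).inter
          (isClosed_iInter fun i => isClosed_le (by fun_prop) continuous_const))
    · refine (Metric.isBounded_closedBall
        (x := (0 : (Fin n → Matrix ι ι ℝ) × Matrix ι ι ℝ)) (r := 1)).subset ?_
      rintro ⟨S, Q⟩ ⟨hS, hQ, -⟩
      rw [mem_closedBall_zero_iff, Prod.norm_def, max_le_iff, pi_norm_le_iff_of_nonneg zero_le_one]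
      exact ⟨fun i => norm_ortho_le (hS i), norm_ortho_le hQ⟩
  convert hc.image continuous_fst using 1
  ext S
  constructor
  · rintro ⟨hS, Q, hQ, h⟩
    exact ⟨(S, Q), ⟨hS, hQ, h⟩, rfl⟩
  · rintro ⟨⟨S', Q⟩, ⟨hS, hQ, h⟩, rfl⟩
    exact ⟨hS, Q, hQ, h⟩

/-- If the power method maps a tube to itself, it has a fixed point there: a maximizer of
`‖Dᵀ S‖_F` over the tube.  Indeed a step does not decrease this convex objective, and increases it
unless every block is already a polar factor. -/
lemma exists_fixedPoint_of_mapsTo (hn : 0 < n) (A : Fin n → Matrix ι κ ℝ) {τ : ℝ} (hτ : 0 ≤ τ)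
    (hmaps : ∀ S ∈ tube n ι τ, ∀ T : Fin n → Matrix ι ι ℝ,
      (∀ i, IsPolar (A i * corr A S) (T i)) → T ∈ tube n ι τ) :
    ∃ S ∈ tube n ι τ, ∀ i, IsPolar (A i * corr A S) (S i) := by
  have hcont : Continuous fun S : Fin n → Matrix ι ι ℝ => ((corr A S)ᵀ * corr A S).trace := by
    unfold corr mean
    fun_prop
  obtain ⟨S, hS, hmax⟩ := (isCompact_tube (n := n) (ι := ι) τ).exists_isMaxOn
    ⟨fun _ => 1, by simp, 1, by simp, by simpa using fun _ => hτ⟩ hcont.continuousOn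
  refine ⟨S, hS, ?_⟩
  choose T hT using fun i => exists_isPolar (A i * corr A S)
  have h1 : ((corr A T)ᵀ * corr A T).trace ≤ ((corr A S)ᵀ * corr A S).trace :=
    hmax (hmaps S hS T hT)
  have h2 : 2 * ((corr A T)ᵀ * corr A S).trace
      ≤ ((corr A T)ᵀ * corr A T).trace + ((corr A S)ᵀ * corr A S).trace := by
    have a1 := trace_transpose_mul_le (corr A T) (corr A S)
    rw [← frob_sq_eq_trace, ← frob_sq_eq_trace]
    nlinarith [sq_nonneg (frob (corr A T) - frob (corr A S))]
  have h3 : ((corr A T)ᵀ * corr A S).trace ≤ ((corr A S)ᵀ * corr A S).trace := by linarith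
  rw [trace_corr_transpose_mul, trace_corr_transpose_mul] at h3
  have h4 : ∀ i, ((S i)ᵀ * (A i * corr A S)).trace ≤ ((T i)ᵀ * (A i * corr A S)).trace :=
    fun i => (hT i).trace_le (hS.1 i)
  have h5 : ∑ i, ((T i)ᵀ * (A i * corr A S)).trace ≤ ∑ i, ((S i)ᵀ * (A i * corr A S)).trace :=
    le_of_mul_le_mul_left h3 (by positivity)
  have h6 := (Finset.sum_eq_sum_iff_of_le fun i _ => h4 i).1
    (le_antisymm (Finset.sum_le_sum fun i _ => h4 i) h5)
  intro i
  refine isPolar_of_isMax_trace (hS.1 i) fun U hU => ?_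
  rw [h6 i (Finset.mem_univ i)]
  exact (hT i).trace_le hU

/-- At a fixed point in the gauge in which `A M` is symmetric, `A M` dominates `Mᵀ M`, which is the
mean of the symmetric matrices `(S i)ᵀ A_i M`.  Hence the deviation of the blocks from the identity
is of the order `δ / σ_min`, without a factor `κ`. -/
lemma norm_fixedPoint_sub_one_le [Nonempty ι] (hn : 0 < n) {A : Matrix ι κ ℝ}
    {Δ : Fin n → Matrix ι κ ℝ} {S : Fin n → Matrix ι ι ℝ} {δ τ r θ : ℝ}
    (hΔ : ∀ i, ‖Δ i‖ ≤ δ) (hS : ∀ i, ‖S i - 1‖ ≤ τ)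
    (hfix : ∀ i, IsPolar ((A + Δ i) * corr (fun i => A + Δ i) S) (S i))
    (hgauge : IsPolar (A * corr (fun i => A + Δ i) S) 1) (hr : 0 < r)
    (hlow : ∀ u, r * l2 u ≤ l2 (corr (fun i => A + Δ i) S *ᵥ u))
    (hθ : δ + τ * ‖A‖ ≤ θ * r) (hθ1 : θ < 1) (i : Fin n) :
    ‖S i - 1‖ ≤ 2 * (δ / (r * (1 - θ))) := by
  set M := corr (fun i => A + Δ i) S with hM
  have hδ : 0 ≤ δ := (norm_nonneg _).trans (hΔ i)
  have hτ : 0 ≤ τ := (norm_nonneg _).trans (hS i)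
  have key : ∀ u, (1 - θ) * l2 (M *ᵥ u) ^ 2 ≤ u ⬝ᵥ (A * M) *ᵥ u := fun u => by
    have h1 : l2 (M *ᵥ u) ^ 2 = mean fun j => (S j *ᵥ u) ⬝ᵥ ((A + Δ j) * M) *ᵥ u := by
      rw [l2_sq]
      refine (dotProduct_corr_mulVec _ _ _ _).trans ?_
      congr 1; ext j
      rw [← mulVec_mulVec, dotProduct_comm]
    have h2 : l2 (M *ᵥ u) ^ 2 ≤ u ⬝ᵥ (A * M) *ᵥ u + (δ + τ * ‖A‖) * (l2 u * l2 (M *ᵥ u)) := by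
      rw [h1]
      refine (mean_mono fun j => ?_).trans (mean_const hn _).le
      have e : (S j *ᵥ u) ⬝ᵥ ((A + Δ j) * M) *ᵥ u = u ⬝ᵥ (A * M) *ᵥ u
          + ((S j - 1) *ᵥ u) ⬝ᵥ A *ᵥ (M *ᵥ u) + (S j *ᵥ u) ⬝ᵥ Δ j *ᵥ (M *ᵥ u) := by
        simp only [Matrix.add_mul, add_mulVec, dotProduct_add, sub_mulVec, one_mulVec,
          sub_dotProduct, ← mulVec_mulVec]
        ring
      have b1 : ((S j - 1) *ᵥ u) ⬝ᵥ A *ᵥ (M *ᵥ u) ≤ (τ * l2 u) * (‖A‖ * l2 (M *ᵥ u)) :=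
        (dotProduct_le _ _).trans (mul_le_mul
          ((l2_mulVec_le _ _).trans (mul_le_mul_of_nonneg_right (hS j) (l2_nonneg _)))
          (l2_mulVec_le _ _) (l2_nonneg _) (mul_nonneg hτ (l2_nonneg _)))
      have b2 : (S j *ᵥ u) ⬝ᵥ Δ j *ᵥ (M *ᵥ u) ≤ l2 u * (δ * l2 (M *ᵥ u)) :=
        (dotProduct_le _ _).trans (mul_le_mul (l2_ortho_mulVec (hfix j).ortho u).le
          ((l2_mulVec_le _ _).trans (mul_le_mul_of_nonneg_right (hΔ j) (l2_nonneg _)))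
          (l2_nonneg _) (l2_nonneg _))
      rw [e]; linarith
    have h3 : (δ + τ * ‖A‖) * (l2 u * l2 (M *ᵥ u)) ≤ θ * l2 (M *ᵥ u) ^ 2 := by
      have hθ0 : 0 ≤ θ := by
        by_contra hneg
        have := mul_neg_of_neg_of_pos (not_le.1 hneg) hr
        have := mul_nonneg hτ (norm_nonneg A)
        linarith
      have := mul_le_mul_of_nonneg_right hθ (mul_nonneg (l2_nonneg u) (l2_nonneg (M *ᵥ u)))
      have h' := mul_le_mul_of_nonneg_left
        (mul_le_mul_of_nonneg_right (hlow u) (l2_nonneg (M *ᵥ u))) hθ0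
      nlinarith
    linarith
  have hfi := hfix i
  rw [Matrix.add_mul] at hfi
  refine hgauge.norm_sub_le hfi ?_ ?_ <;> rw [transpose_one, Matrix.one_mul]
  · intro u hu
    have := (mul_pos hr (l2_pos hu)).trans_le (hlow u)
    exact (mul_pos (by linarith) (pow_pos this 2)).trans_le (key u)
  · intro u
    have h1 : l2 ((Δ i * M) *ᵥ u) ≤ δ * l2 (M *ᵥ u) := by
      rw [← mulVec_mulVec]
      exact (l2_mulVec_le _ _).trans (mul_le_mul_of_nonneg_right (hΔ i) (l2_nonneg _))
    have h2 : 0 < 1 - θ := by linarith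
    calc l2 u * l2 ((Δ i * M) *ᵥ u) ≤ l2 u * (δ * l2 (M *ᵥ u)) :=
          mul_le_mul_of_nonneg_left h1 (l2_nonneg _)
      _ = δ / (r * (1 - θ)) * ((1 - θ) * (r * l2 u * l2 (M *ᵥ u))) := by field_simp
      _ ≤ δ / (r * (1 - θ)) * ((1 - θ) * l2 (M *ᵥ u) ^ 2) := by
          rw [sq]
          have := mul_le_mul_of_nonneg_right (hlow u) (l2_nonneg (M *ᵥ u))
          gcongr
      _ ≤ _ := mul_le_mul_of_nonneg_left (key u) (by positivity)

end

section
variable {ι κ : Type*} [Fintype ι] [Fintype κ] [DecidableEq ι] [DecidableEq κ]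
variable {n : ℕ}

/-! ### Contraction towards a fixed point -/

/-- `‖1 - V‖_F ≤ ‖1 - V V‖_F`: write `1 - V V = (1 - V) + (1 - V) V` and note that the inner product
of the two terms is nonnegative. -/
lemma frob_one_sub_le_of_posSemidef {V : Matrix ι ι ℝ} (hV : ∀ u, 0 ≤ u ⬝ᵥ V *ᵥ u) :
    frob (1 - V) ≤ frob (1 - V * V) := by
  refine le_of_sq_le_sq ?_ (frob_nonneg _)
  have e : 1 - V * V = (1 - V) + (1 - V) * V := by noncomm_ring
  have h1 : 0 ≤ ((1 - V) * V * (1 - V)ᵀ).trace := by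
    have := le_trace_mul_mul_transpose (1 - V) (H := V) (h := 0) (fun u => by simpa using hV u)
    simpa using this
  have h2 : ((1 - V) * V * (1 - V)ᵀ).trace = ((1 - V)ᵀ * ((1 - V) * V)).trace :=
    trace_mul_comm _ _
  have h3 : (((1 - V) * V)ᵀ * (1 - V)).trace = ((1 - V)ᵀ * ((1 - V) * V)).trace := by
    rw [← trace_transpose, transpose_mul _ (1 - V), transpose_transpose]
  rw [e, frob_sq_eq_trace (1 - V + _), transpose_add, Matrix.add_mul, Matrix.mul_add,
    Matrix.mul_add, trace_add, trace_add, trace_add, h3, ← frob_sq_eq_trace, ← frob_sq_eq_trace]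
  nlinarith [sq_nonneg (frob ((1 - V) * V))]

/-- If the mean of orthogonal matrices is positive semidefinite (which is the optimal gauge), it
differs from the identity only to second order. -/
lemma frob_one_sub_mean_le (hn : 0 < n) {V : Fin n → Matrix ι ι ℝ} {Q : Matrix ι ι ℝ} {t w : ℝ}
    (hV : ∀ i, (V i)ᵀ * V i = 1) (hsymm : (mean V)ᵀ = mean V)
    (hpsd : ∀ u, 0 ≤ u ⬝ᵥ mean V *ᵥ u) (ht : 0 ≤ t) (hw : 0 ≤ w)
    (hVt : mean (fun i => ‖V i - Q‖ ^ 2) ≤ t ^ 2)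
    (hVw : mean (fun i => frob (V i - 1) ^ 2) ≤ w ^ 2) : frob (1 - mean V) ≤ 2 * t * w := by
  refine (frob_one_sub_le_of_posSemidef hpsd).trans ?_
  have e : 1 - mean V * mean V = mean fun i => (V i - mean V)ᵀ * (V i - 1) := by
    simp only [transpose_sub, Matrix.sub_mul, Matrix.mul_sub, mean_sub, hV, Matrix.mul_one,
      ← transpose_mean, mean_const hn, ← mul_mean, hsymm]
    abel
  rw [e]
  have hmQ := norm_mean_sub_le hn ht hVt
  refine (frob_mean_le _).trans ?_
  have h1 : mean (fun i => frob ((V i - mean V)ᵀ * (V i - 1)))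
      ≤ mean fun i => (‖V i - Q‖ + t) * frob (V i - 1) := by
    refine mean_mono fun i => (frob_mul_le _ _).trans ?_
    refine mul_le_mul_of_nonneg_right ?_ (frob_nonneg _)
    rw [norm_transpose]
    have : V i - mean V = (V i - Q) - (mean V - Q) := by abel
    rw [this]
    exact (norm_sub_le _ _).trans (by linarith)
  have h2 := mean_mul_le (by linarith) hw (mean_add_sq_le hn ht ht hVt) hVw
  linarith

/-- The contraction estimate.  Here `B i = (S∞ i)ᵀ A_i` are the data rotated by a fixed point, so
that all `B i * (mean B)ᵀ` are symmetric, and `V i = (S∞ i)ᵀ S i` are the relative rotations, in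
the gauge that makes their mean positive semidefinite.  All `B i * corr B V` are compared with the
polar factor `Q` of `mean B * corr B V`; as the fixed-point equation is exact, the difference is
quadratic in the spreads `f` of the data and `t` of the rotations. -/
lemma exists_frob_step_sub_le (hn : 0 < n) {B : Fin n → Matrix ι κ ℝ} {V R : Fin n → Matrix ι ι ℝ}
    {Q₁ : Matrix ι ι ℝ} {f b s k t w : ℝ}
    (hsymB : ∀ i, (B i * (mean B)ᵀ)ᵀ = B i * (mean B)ᵀ)
    (hf : ∀ i, ‖B i - mean B‖ ≤ f) (hb : ‖mean B‖ ≤ b) (hs : 0 < s)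
    (hlow : ∀ u, s * l2 u ≤ l2 ((mean B)ᵀ *ᵥ u))
    (hV : ∀ i, (V i)ᵀ * V i = 1) (hsymm : (mean V)ᵀ = mean V)
    (hpsd : ∀ u, 0 ≤ u ⬝ᵥ mean V *ᵥ u) (ht : 0 ≤ t) (hw : 0 ≤ w)
    (hVt : mean (fun i => ‖V i - Q₁‖ ^ 2) ≤ t ^ 2)
    (hVw : mean (fun i => frob (V i - 1) ^ 2) ≤ w ^ 2)
    (hk : ∀ u, k * l2 u ≤ l2 ((mean B * corr B V) *ᵥ u)) (hkf : 0 < k - f * b)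
    (hR : ∀ i, IsPolar (B i * corr B V) (R i)) :
    ∃ Q : Matrix ι ι ℝ, Qᵀ * Q = 1 ∧ ∀ i,
      frob (R i - Q) ≤ 2 * (f * (1 + 2 * b / s) * ((2 * b * t + f) * w)) / (k - f * b) := by
  have hb0 : 0 ≤ b := (norm_nonneg _).trans hb
  have hf0 : 0 ≤ f := (norm_nonneg _).trans (hf ⟨0, hn⟩)
  set Bm := mean B with hBm
  set g := (2 * b * t + f) * w with hg
  have hg0 : 0 ≤ g := by positivity
  obtain ⟨G, hG⟩ : ∃ G, G = corr B V - Bmᵀ := ⟨_, rfl⟩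
  have hGle : frob G ≤ g := by
    have e : G = (mean fun j => (B j - Bm)ᵀ * (V j - 1)) - Bmᵀ * (1 - mean V) := by
      simp only [hG, corr, transpose_sub, Matrix.sub_mul, Matrix.mul_sub, mean_sub, Matrix.mul_one,
        ← transpose_mean, mean_const hn, ← mul_mean, ← hBm]
      abel
    have h1 := frob_one_sub_mean_le hn hV hsymm hpsd ht hw hVt hVw
    have h2 : frob (Bmᵀ * (1 - mean V)) ≤ b * (2 * t * w) := by
      refine (frob_mul_le _ _).trans ?_
      rw [norm_transpose]
      exact mul_le_mul hb h1 (frob_nonneg _) hb0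
    have h3 : frob (mean fun j => (B j - Bm)ᵀ * (V j - 1)) ≤ f * w := by
      refine (frob_mean_le _).trans
        ((mean_mono (b := fun j => f * frob (V j - 1)) fun j => ?_).trans ?_)
      · refine (frob_mul_le _ _).trans ?_
        rw [norm_transpose]
        exact mul_le_mul_of_nonneg_right (hf j) (frob_nonneg _)
      · rw [mean_const_mul]
        exact mul_le_mul_of_nonneg_left (mean_le_of_mean_sq_le hn hw hVw) hf0
    rw [e]
    refine (frob_sub_le _ _).trans ?_
    rw [hg]; linarith
  have hMG : corr B V = Bmᵀ + G := by rw [hG]; abel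
  obtain ⟨Q, hQ⟩ := exists_isPolar (Bm * corr B V)
  have hQ1 : frob (Q - 1) ≤ 2 * g / s := by
    have hQ' := hQ
    rw [hMG, Matrix.mul_add] at hQ'
    refine (hQ'.frob_sub_one_le_of_gram hs hlow).trans ?_
    gcongr
  refine ⟨Q, hQ.ortho, fun i => ?_⟩
  have hQt := ortho_transpose hQ.ortho
  have hFsymm : ((B i - Bm) * Bmᵀ)ᵀ = (B i - Bm) * Bmᵀ := by
    rw [Matrix.sub_mul, transpose_sub, hsymB i, transpose_mul, transpose_transpose]
  have hpol := (hR i).mul_left hQt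
  have e : Qᵀ * (B i * corr B V) = (Qᵀ * (Bm * corr B V) + (B i - Bm) * Bmᵀ)
      + ((Q - 1)ᵀ * ((B i - Bm) * Bmᵀ) + Qᵀ * ((B i - Bm) * G)) := by
    have : B i * corr B V = Bm * corr B V + (B i - Bm) * Bmᵀ + (B i - Bm) * G := by
      rw [add_assoc, ← Matrix.mul_add, ← hMG, Matrix.sub_mul]; abel
    rw [this, transpose_sub, transpose_one, Matrix.sub_mul Qᵀ, Matrix.one_mul, Matrix.mul_add,
      Matrix.mul_add]
    abel
  rw [e] at hpol
  have hbnd := hpol.frob_sub_one_le (by rw [transpose_add, hQ.symm, hFsymm]) hkf (fun u => by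
    have h1 := hQ.le_of_l2_le hk u
    have h2 : -(f * b * l2 u ^ 2) ≤ u ⬝ᵥ ((B i - Bm) * Bmᵀ) *ᵥ u := by
      refine le_trans ?_ (neg_le_dotProduct _ _)
      have h3 : l2 (((B i - Bm) * Bmᵀ) *ᵥ u) ≤ f * b * l2 u := by
        refine (l2_mulVec_le _ _).trans (mul_le_mul_of_nonneg_right ?_ (l2_nonneg _))
        refine (norm_mul_le' _ _).trans ?_
        rw [norm_transpose]
        exact mul_le_mul (hf i) hb (norm_nonneg _) hf0
      nlinarith [mul_le_mul_of_nonneg_left h3 (l2_nonneg u)]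
    rw [add_mulVec, dotProduct_add]
    linarith)
  have hE : frob ((Q - 1)ᵀ * ((B i - Bm) * Bmᵀ) + Qᵀ * ((B i - Bm) * G))
      ≤ f * (1 + 2 * b / s) * g := by
    refine (frob_add_le _ _).trans ?_
    have h1 : frob ((Q - 1)ᵀ * ((B i - Bm) * Bmᵀ)) ≤ 2 * g / s * (f * b) := by
      refine (frob_mul_le' _ _).trans ?_
      rw [frob_transpose]
      refine mul_le_mul hQ1 ?_ (norm_nonneg _) (by positivity)
      refine (norm_mul_le' _ _).trans ?_
      rw [norm_transpose]
      exact mul_le_mul (hf i) hb (norm_nonneg _) hf0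
    have h2 : frob (Qᵀ * ((B i - Bm) * G)) ≤ f * g := by
      rw [frob_ortho_mul hQt]
      exact (frob_mul_le _ _).trans (mul_le_mul (hf i) hGle (frob_nonneg _) hf0)
    refine (add_le_add h1 h2).trans (le_of_eq ?_)
    field_simp
    ring
  have e2 : R i - Q = Q * (Qᵀ * R i - 1) := by
    rw [mul_sub, ← Matrix.mul_assoc, mul_eq_one_comm.1 hQ.ortho, Matrix.one_mul, Matrix.mul_one]
  rw [e2, frob_ortho_mul hQ.ortho]
  refine hbnd.trans ?_
  gcongr

/-! ### The dual certificate of the semidefinite program -/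

/-- The quadratic form of the dual certificate is positive off the span of the fixed point. -/
lemma mean_sq_sub_mean_le (hn : 0 < n) {B : Fin n → Matrix ι κ ℝ} {f b s : ℝ}
    (hsymB : ∀ i, (B i * (mean B)ᵀ)ᵀ = B i * (mean B)ᵀ)
    (hf : ∀ i, ‖B i - mean B‖ ≤ f) (hb : ‖mean B‖ ≤ b) (hs : 0 ≤ s)
    (hlow : ∀ u, s * l2 u ≤ l2 ((mean B)ᵀ *ᵥ u)) (z : Fin n → ι → ℝ) :
    (s ^ 2 - f * b - f ^ 2) * mean (fun i => l2 (z i - mean z) ^ 2)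
      ≤ mean (fun i => z i ⬝ᵥ (B i * (mean B)ᵀ) *ᵥ z i)
        - l2 (mean fun i => (B i)ᵀ *ᵥ z i) ^ 2 := by
  have hb0 : 0 ≤ b := (norm_nonneg _).trans hb
  have hf0 : 0 ≤ f := (norm_nonneg _).trans (hf ⟨0, hn⟩)
  set Bm := mean B with hBm
  set zm := mean z with hzm
  obtain ⟨y, hy⟩ : ∃ y : Fin n → ι → ℝ, y = fun i => z i - zm := ⟨_, rfl⟩
  have hy0 : mean y = 0 := by rw [hy, mean_sub, mean_const hn, ← hzm, sub_self]
  have hz : ∀ i, z i = zm + y i := fun i => by rw [hy]; simp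
  set g := mean fun i => (B i - Bm)ᵀ *ᵥ y i with hg
  have hBy : mean (fun i => (B i)ᵀ *ᵥ y i) = g := by
    have : mean (fun i => Bmᵀ *ᵥ y i) = 0 := by
      have := map_mean (Bmᵀ).mulVecLin y
      rw [hy0, map_zero] at this
      exact this.symm
    simp only [hg, transpose_sub, sub_mulVec, mean_sub, this, sub_zero]
  have hBz : mean (fun i => (B i)ᵀ *ᵥ z i) = Bmᵀ *ᵥ zm + g := by
    rw [← hBy, hBm, transpose_mean, mean_mulVec, ← mean_add]
    congr 1; ext1 i
    rw [hz i, mulVec_add]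
  have hquad : mean (fun i => z i ⬝ᵥ (B i * Bmᵀ) *ᵥ z i) = l2 (Bmᵀ *ᵥ zm) ^ 2
      + 2 * ((Bmᵀ *ᵥ zm) ⬝ᵥ g) + mean (fun i => y i ⬝ᵥ (B i * Bmᵀ) *ᵥ y i) := by
    have h1 : mean (fun i => zm ⬝ᵥ (B i * Bmᵀ) *ᵥ zm) = l2 (Bmᵀ *ᵥ zm) ^ 2 := by
      rw [← dotProduct_mean, ← mean_mulVec, ← mean_mul, ← hBm, l2_mulVec_sq, transpose_transpose]
    have h2 : mean (fun i => zm ⬝ᵥ (B i * Bmᵀ) *ᵥ y i) = (Bmᵀ *ᵥ zm) ⬝ᵥ g := by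
      rw [← hBy, dotProduct_mean]
      congr 1; ext1 i
      rw [← hsymB i, transpose_mul, transpose_transpose, ← mulVec_mulVec, dotProduct_mulVec_comm]
    rw [← h1, ← h2, ← mean_const_mul, ← mean_add, ← mean_add]
    congr 1; ext1 i
    rw [hz i, mulVec_add, dotProduct_add, add_dotProduct, add_dotProduct,
      dotProduct_mulVec_symm (hsymB i) (y i) zm]
    ring
  have hgle : l2 g ^ 2 ≤ f ^ 2 * mean fun i => l2 (y i) ^ 2 := by
    have h1 : l2 g ≤ mean fun i => f * l2 (y i) := by
      have := norm_mean_le fun i => (WithLp.toLp 2 ((B i - Bm)ᵀ *ᵥ y i) : EuclideanSpace ℝ κ)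
      have e : WithLp.toLp 2 g = mean fun i =>
          (WithLp.toLp 2 ((B i - Bm)ᵀ *ᵥ y i) : EuclideanSpace ℝ κ) :=
        map_mean (WithLp.linearEquiv 2 ℝ (κ → ℝ)).symm.toLinearMap _
      rw [l2, e]
      refine this.trans (mean_mono fun i => ?_)
      refine (l2_mulVec_le _ _).trans ?_
      rw [norm_transpose]
      exact mul_le_mul_of_nonneg_right (hf i) (l2_nonneg _)
    have h2 := mean_mul_sq_le (fun i => l2 (y i)) fun _ => 1
    simp only [mul_one, one_pow, mean_const hn] at h2
    rw [mean_const_mul] at h1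
    calc l2 g ^ 2 ≤ (f * mean fun i => l2 (y i)) ^ 2 := pow_le_pow_left₀ (l2_nonneg _) h1 2
      _ ≤ _ := by rw [mul_pow]; exact mul_le_mul_of_nonneg_left h2 (sq_nonneg _)
  have hylow : (s ^ 2 - f * b) * mean (fun i => l2 (y i) ^ 2)
      ≤ mean (fun i => y i ⬝ᵥ (B i * Bmᵀ) *ᵥ y i) := by
    rw [← mean_const_mul]
    refine mean_mono fun i => ?_
    have h1 : y i ⬝ᵥ (B i * Bmᵀ) *ᵥ y i
        = l2 (Bmᵀ *ᵥ y i) ^ 2 + ((B i - Bm)ᵀ *ᵥ y i) ⬝ᵥ Bmᵀ *ᵥ y i := by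
      rw [l2_sq, transpose_sub, sub_mulVec, sub_dotProduct, ← mulVec_mulVec,
        dotProduct_mulVec_comm]
      ring
    have h2 : (s * l2 (y i)) ^ 2 ≤ l2 (Bmᵀ *ᵥ y i) ^ 2 :=
      pow_le_pow_left₀ (mul_nonneg hs (l2_nonneg _)) (hlow _) 2
    have h3 : l2 ((B i - Bm)ᵀ *ᵥ y i) * l2 (Bmᵀ *ᵥ y i) ≤ (f * l2 (y i)) * (b * l2 (y i)) := by
      refine mul_le_mul ?_ ?_ (l2_nonneg _) (mul_nonneg hf0 (l2_nonneg _))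
      · refine (l2_mulVec_le _ _).trans (mul_le_mul_of_nonneg_right ?_ (l2_nonneg _))
        rw [norm_transpose]; exact hf i
      · refine (l2_mulVec_le _ _).trans (mul_le_mul_of_nonneg_right ?_ (l2_nonneg _))
        rw [norm_transpose]; exact hb
    have h4 := neg_le_dotProduct ((B i - Bm)ᵀ *ᵥ y i) (Bmᵀ *ᵥ y i)
    rw [h1]
    nlinarith
  have hyy : mean (fun i => l2 (z i - zm) ^ 2) = mean fun i => l2 (y i) ^ 2 := by rw [hy]
  have hsum : l2 (Bmᵀ *ᵥ zm + g) ^ 2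
      = l2 (Bmᵀ *ᵥ zm) ^ 2 + 2 * ((Bmᵀ *ᵥ zm) ⬝ᵥ g) + l2 g ^ 2 := by
    simp only [l2_sq, dotProduct_add, add_dotProduct, dotProduct_comm g]
    ring
  rw [hyy, hBz, hquad, hsum]
  linarith

end

section
variable {n d m k : ℕ}

/-! ### Stacks of blocks -/

lemma block_stack (B : Fin n → Matrix (Fin d) (Fin k) ℝ) : block (stack B) = B := rfl

lemma stack_block (S : Matrix (Fin n × Fin d) (Fin k) ℝ) : stack (block S) = S := rfl

lemma block_injective : Function.Injective (block : Matrix (Fin n × Fin d) (Fin k) ℝ → _) :=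
  fun S T h => by rw [← stack_block S, h, stack_block]

lemma block_sub_mul {l : ℕ} (X : Matrix (Fin n × Fin d) (Fin k) ℝ)
    (Y : Matrix (Fin n × Fin d) (Fin l) ℝ) (Q : Matrix (Fin l) (Fin k) ℝ) (i : Fin n) :
    block (X - Y * Q) i = block X i - block Y i * Q := rfl

lemma stack_transpose_mul (A : Fin n → Matrix (Fin d) (Fin m) ℝ)
    (S : Matrix (Fin n × Fin d) (Fin k) ℝ) :
    (stack A)ᵀ * S = ∑ j, (A j)ᵀ * block S j := by
  ext a b
  simp [Matrix.mul_apply, Fintype.sum_prod_type, Matrix.sum_apply, stack, block]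

lemma dataD_eq (A : Matrix (Fin d) (Fin m) ℝ) (Δ : Fin n → Matrix (Fin d) (Fin m) ℝ) :
    dataD A Δ = stack fun i => A + Δ i := by
  apply block_injective
  ext i : 1
  change (1 : Matrix (Fin d) (Fin d) ℝ) * A + Δ i = A + Δ i
  rw [Matrix.one_mul]

lemma block_dataC_mul (hn : 0 < n) (A : Matrix (Fin d) (Fin m) ℝ)
    (Δ : Fin n → Matrix (Fin d) (Fin m) ℝ) (S : Matrix (Fin n × Fin d) (Fin d) ℝ) (i : Fin n) :
    block (dataC A Δ * S) i = (n : ℝ) • ((A + Δ i) * corr (fun i => A + Δ i) (block S)) := by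
  rw [dataC, dataD_eq, Matrix.mul_assoc, stack_transpose_mul, ← Matrix.mul_smul, corr,
    natCast_smul_mean hn]
  rfl

lemma isGPMStep_iff (hn : 0 < n) {A : Matrix (Fin d) (Fin m) ℝ}
    {Δ : Fin n → Matrix (Fin d) (Fin m) ℝ} {S T : Matrix (Fin n × Fin d) (Fin d) ℝ} :
    IsGPMStep (dataC A Δ) S T ↔
      ∀ i, IsPolar ((A + Δ i) * corr (fun i => A + Δ i) (block S)) (block T i) := by
  have hn' : (0 : ℝ) < n := by exact_mod_cast hn
  refine forall_congr' fun i => ?_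
  rw [isProj_iff_isPolar, block_dataC_mul hn]
  constructor
  · intro h
    have := h.smul (inv_nonneg.2 hn'.le)
    rwa [smul_smul, inv_mul_cancel₀ hn'.ne', one_smul] at this
  · exact fun h => h.smul hn'.le

lemma isOrthStack_iff {S : Matrix (Fin n × Fin d) (Fin d) ℝ} :
    IsOrthStack S ↔ ∀ i, (block S i)ᵀ * block S i = 1 :=
  forall_congr' fun _ => mem_orthogonalGroup_iff_transpose

lemma frob_sq_eq_mean (hn : 0 < n) (X : Matrix (Fin n × Fin d) (Fin k) ℝ) :
    frob X ^ 2 = n * mean fun i => frob (block X i) ^ 2 := by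
  rw [← smul_eq_mul, natCast_smul_mean hn, frob_sq, Fintype.sum_prod_type]
  exact Finset.sum_congr rfl fun i _ => (frob_sq _).symm

/-! ### The distance modulo a global rotation -/

lemma dF_le {X Y : Matrix (Fin n × Fin d) (Fin d) ℝ} {Q : Matrix (Fin d) (Fin d) ℝ}
    (hQ : Qᵀ * Q = 1) : dF X Y ≤ frob (X - Y * Q) :=
  ciInf_le (f := fun Q : Matrix.orthogonalGroup (Fin d) ℝ =>
      frob (X - Y * (Q : Matrix (Fin d) (Fin d) ℝ)))
    ⟨0, by rintro _ ⟨Q, rfl⟩; exact frob_nonneg _⟩ ⟨Q, mem_orthogonalGroup_iff_transpose.2 hQ⟩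

lemma dF_nonneg (X Y : Matrix (Fin n × Fin d) (Fin d) ℝ) : 0 ≤ dF X Y :=
  Real.iInf_nonneg fun _ => frob_nonneg _

/-- The distance is attained at the polar factor of the mean of the relative rotations. -/
lemma exists_dF_eq (hn : 0 < n) (X : Matrix (Fin n × Fin d) (Fin d) ℝ)
    {Y : Matrix (Fin n × Fin d) (Fin d) ℝ} (hY : IsOrthStack Y) :
    ∃ Q : Matrix (Fin d) (Fin d) ℝ, IsPolar (mean fun i => (block Y i)ᵀ * block X i) Q ∧
      dF X Y = frob (X - Y * Q) := by
  rw [isOrthStack_iff] at hY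
  obtain ⟨Q, hQ⟩ := exists_isPolar (mean fun i => (block Y i)ᵀ * block X i)
  refine ⟨Q, hQ, le_antisymm (dF_le hQ.ortho) ?_⟩
  have key : ∀ U : Matrix (Fin d) (Fin d) ℝ, Uᵀ * U = 1 → frob (X - Y * U) ^ 2
      = n * ((1 : Matrix (Fin d) (Fin d) ℝ).trace
        - 2 * (Uᵀ * mean fun i => (block Y i)ᵀ * block X i).trace
        + mean fun i => frob ((block Y i)ᵀ * block X i) ^ 2) := fun U hU => by
    rw [frob_sq_eq_mean hn]
    congr 1
    calc (mean fun i => frob (block (X - Y * U) i) ^ 2)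
        = mean fun i => (1 : Matrix (Fin d) (Fin d) ℝ).trace
          - 2 * (Uᵀ * ((block Y i)ᵀ * block X i)).trace
          + frob ((block Y i)ᵀ * block X i) ^ 2 := by
          congr 1; ext1 i
          rw [← frob_sub_sq hU, frob_sub_comm U, block_sub_mul]
          have : (block Y i)ᵀ * block X i - U
              = (block Y i)ᵀ * (block X i - block Y i * U) := by
            rw [Matrix.mul_sub, ← Matrix.mul_assoc _ _ U, hY i, Matrix.one_mul]
          rw [this, frob_ortho_mul (ortho_transpose (hY i))]
      _ = _ := by
          rw [mean_add, mean_sub, mean_const hn, mean_const_mul, ← trace_mean, ← mul_mean]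
  refine le_ciInf fun U => le_of_sq_le_sq ?_ (frob_nonneg _)
  have hU := mem_orthogonalGroup_iff_transpose.1 U.2
  rw [key Q hQ.ortho, key _ hU]
  have := hQ.trace_le hU
  gcongr

lemma exists_eq_mul_of_dF_eq_zero (hn : 0 < n) {X Y : Matrix (Fin n × Fin d) (Fin d) ℝ}
    (hY : IsOrthStack Y) (h : dF X Y = 0) :
    ∃ Q ∈ Matrix.orthogonalGroup (Fin d) ℝ, X = Y * Q := by
  obtain ⟨Q, hQ, hd⟩ := exists_dF_eq hn X hY
  refine ⟨Q, mem_orthogonalGroup_iff_transpose.2 hQ.ortho, ?_⟩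
  rw [h] at hd
  exact sub_eq_zero.1 (frob_eq_zero.1 hd.symm)

lemma dF_triangle (hn : 0 < n) {W X Y : Matrix (Fin n × Fin d) (Fin d) ℝ}
    (hX : IsOrthStack X) (hY : IsOrthStack Y) : dF X Y ≤ dF W X + dF W Y := by
  obtain ⟨P, hP, hdP⟩ := exists_dF_eq hn W hX
  obtain ⟨Q, hQ, hdQ⟩ := exists_dF_eq hn W hY
  have hPt := ortho_transpose hP.ortho
  refine (dF_le (ortho_mul hQ.ortho hPt)).trans ?_
  have e : X - Y * (Q * Pᵀ) = ((W - Y * Q) - (W - X * P)) * Pᵀ := by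
    have : X * P * Pᵀ = X := by
      rw [Matrix.mul_assoc, mul_eq_one_comm.1 hP.ortho, Matrix.mul_one]
    rw [sub_sub_sub_cancel_left, Matrix.sub_mul, this, Matrix.mul_assoc]
  rw [e, frob_mul_ortho hPt, hdP, hdQ, add_comm]
  exact frob_sub_le _ _

/-! ### Tightness of the semidefinite program -/

lemma sdpFeasible_mul_transpose {S : Matrix (Fin n × Fin d) (Fin d) ℝ} (hS : IsOrthStack S) :
    SDPFeasible (S * Sᵀ) := by
  rw [isOrthStack_iff] at hS
  refine ⟨?_, fun i => ?_⟩
  · have := posSemidef_self_mul_conjTranspose S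
    rwa [conjTranspose_eq_transpose_of_trivial] at this
  · exact mul_eq_one_comm.1 (hS i)

open scoped MatrixOrder in
lemma exists_eq_transpose_mul_self {ι : Type*} [Fintype ι] {G : Matrix ι ι ℝ}
    (hG : G.PosSemidef) : ∃ R : Matrix ι ι ℝ, G = Rᵀ * R := by
  classical
  obtain ⟨R, hR⟩ := CStarAlgebra.nonneg_iff_eq_star_mul_self.1 hG.nonneg
  exact ⟨R, hR⟩

/-- For `G = Rᵀ R`, the objective is a sum over the rows of `R`. -/
lemma sdpObj_transpose_mul_self (hn : 0 < n) {p : Type*} [Fintype p]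
    (A : Matrix (Fin d) (Fin m) ℝ) (Δ : Fin n → Matrix (Fin d) (Fin m) ℝ)
    (R : Matrix p (Fin n × Fin d) ℝ) :
    sdpObj (dataC A Δ) (Rᵀ * R)
      = n ^ 2 * ∑ r, l2 (mean fun i => (A + Δ i)ᵀ *ᵥ fun a => R r (i, a)) ^ 2 := by
  have h1 : sdpObj (dataC A Δ) (Rᵀ * R) = frob ((R * dataD A Δ)ᵀ) ^ 2 := by
    rw [sdpObj, dataC, transpose_mul, transpose_transpose, frob_transpose, frob_sq_eq_trace,
      transpose_mul, Matrix.mul_assoc, trace_mul_comm]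
    simp only [Matrix.mul_assoc]
  have h2 : ∀ r, (fun j => (R * dataD A Δ)ᵀ j r)
      = (n : ℝ) • mean fun i => (A + Δ i)ᵀ *ᵥ fun a => R r (i, a) := fun r => by
    rw [natCast_smul_mean hn, dataD_eq]
    ext j
    simp [Matrix.mul_apply, Fintype.sum_prod_type, stack, mulVec, dotProduct, mul_comm]
  rw [h1, frob_sq_eq_sum_col, Finset.mul_sum]
  refine Finset.sum_congr rfl fun r _ => ?_
  rw [h2, l2_smul, mul_pow, sq_abs]

/-- The diagonal blocks of a feasible `G = Rᵀ R` turn block quadratic forms into traces. -/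
lemma sum_quadForm_eq_trace {p : Type*} [Fintype p] {R : Matrix p (Fin n × Fin d) ℝ} {i : Fin n}
    (hi : (Matrix.of fun a b => (Rᵀ * R) (i, a) (i, b) : Matrix (Fin d) (Fin d) ℝ) = 1)
    (L : Matrix (Fin d) (Fin d) ℝ) :
    ∑ r, (fun a => R r (i, a)) ⬝ᵥ L *ᵥ (fun a => R r (i, a)) = L.trace := by
  classical
  have h : (R.submatrix id fun a => (i, a))ᵀ * (R.submatrix id fun a => (i, a)) = 1 := hi
  have h2 := trace_mul_mul_transpose (R.submatrix id fun a => (i, a)) L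
  rw [trace_mul_comm, ← Matrix.mul_assoc, h, Matrix.one_mul] at h2
  rw [h2]
  rfl

/-- Tightness: if the certificate is positive definite off the span of the fixed point `Y`, then
`Y Yᵀ` is the unique maximizer. -/
lemma isUniqueSDPMaximizer_of_fixedPoint (hn : 0 < n) {A : Matrix (Fin d) (Fin m) ℝ}
    {Δ : Fin n → Matrix (Fin d) (Fin m) ℝ} {Y : Fin n → Matrix (Fin d) (Fin d) ℝ}
    (hY : ∀ i, (Y i)ᵀ * Y i = 1) {h : ℝ} (hh : 0 < h)
    (hcert : ∀ z : Fin n → Fin d → ℝ, h * mean (fun i => l2 (z i - mean z) ^ 2)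
      ≤ mean (fun i => z i ⬝ᵥ ((Y i)ᵀ * ((A + Δ i) * corr (fun i => A + Δ i) Y)) *ᵥ z i)
        - l2 (mean fun i => ((Y i)ᵀ * (A + Δ i))ᵀ *ᵥ z i) ^ 2) :
    IsUniqueSDPMaximizer (dataC A Δ) (stack Y * (stack Y)ᵀ) := by
  have hYt : ∀ i, Y i * (Y i)ᵀ = 1 := fun i => mul_eq_one_comm.1 (hY i)
  have hn' : (0 : ℝ) < n := by exact_mod_cast hn
  have hOrth : IsOrthStack (stack Y) := isOrthStack_iff.2 hY
  set M := corr (fun i => A + Δ i) Y with hM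
  set L : Fin n → Matrix (Fin d) (Fin d) ℝ := fun i => (A + Δ i) * M * (Y i)ᵀ with hL
  have hobjY : sdpObj (dataC A Δ) (stack Y * (stack Y)ᵀ) = n ^ 2 * mean fun i => (L i).trace := by
    have h1 := sdpObj_transpose_mul_self hn A Δ (stack Y)ᵀ
    rw [transpose_transpose] at h1
    rw [h1]
    congr 1
    have h2 : (mean fun i => (L i).trace) = (Mᵀ * M).trace := by
      conv_rhs => rw [hM, trace_corr_transpose_mul]
      congr 1; ext1 i
      rw [hL]
      exact trace_mul_comm _ _
    rw [h2, ← frob_sq_eq_trace, frob_sq_eq_sum_col]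
    refine Finset.sum_congr rfl fun r _ => ?_
    congr 2
    ext j
    simp [hM, corr, mean, Matrix.sum_apply, Matrix.mul_apply, mulVec, dotProduct, stack]
  refine ⟨sdpFeasible_mul_transpose hOrth, fun G hG hne => ?_⟩
  obtain ⟨R, rfl⟩ : ∃ R : Matrix (Fin n × Fin d) (Fin n × Fin d) ℝ, G = Rᵀ * R :=
    exists_eq_transpose_mul_self hG.1
  set u : (Fin n × Fin d) → Fin n → Fin d → ℝ := fun r i a => R r (i, a) with hu
  set z : (Fin n × Fin d) → Fin n → Fin d → ℝ := fun r i => (Y i)ᵀ *ᵥ u r i with hz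
  have hYz : ∀ r i, Y i *ᵥ z r i = u r i := fun r i => by
    rw [hz]; simp only [mulVec_mulVec, hYt, one_mulVec]
  have hrow : ∀ r, h * mean (fun i => l2 (z r i - mean (z r)) ^ 2)
      ≤ mean (fun i => u r i ⬝ᵥ L i *ᵥ u r i)
        - l2 (mean fun i => (A + Δ i)ᵀ *ᵥ u r i) ^ 2 := fun r => by
    refine (hcert (z r)).trans (le_of_eq ?_)
    congr 1
    · congr 1; ext1 i
      rw [dotProduct_transpose_mul_mulVec, hYz]
      simp only [hL, hz, mulVec_mulVec, Matrix.mul_assoc]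
    · congr 3; ext1 i
      rw [transpose_mul, transpose_transpose, ← mulVec_mulVec, hYz]
  have hobjG : sdpObj (dataC A Δ) (Rᵀ * R) = n ^ 2 * ((mean fun i => (L i).trace)
      - ∑ r, (mean (fun i => u r i ⬝ᵥ L i *ᵥ u r i)
        - l2 (mean fun i => (A + Δ i)ᵀ *ᵥ u r i) ^ 2)) := by
    have h1 : ∑ r, mean (fun i => u r i ⬝ᵥ L i *ᵥ u r i) = mean fun i => (L i).trace := by
      simp only [mean, smul_eq_mul, ← Finset.mul_sum]
      rw [Finset.sum_comm]
      congr 1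
      exact Finset.sum_congr rfl fun i _ => sum_quadForm_eq_trace (hG.2 i) (L i)
    rw [sdpObj_transpose_mul_self hn, Finset.sum_sub_distrib, h1, sub_sub_cancel]
  rw [hobjY, hobjG]
  refine mul_lt_mul_of_pos_left ?_ (by positivity)
  have hterm : ∀ r, 0 ≤ mean fun i => l2 (z r i - mean (z r)) ^ 2 := fun r =>
    mean_nonneg fun i => sq_nonneg _
  by_contra hle
  push Not at hle
  -- otherwise every row of `R` lies in the span of the columns of the fixed point
  have hzero : ∑ r, h * mean (fun i => l2 (z r i - mean (z r)) ^ 2) ≤ 0 :=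
    (Finset.sum_le_sum fun r _ => hrow r).trans (by linarith)
  have hz0 : ∀ r i, z r i = mean (z r) := fun r i => by
    have h1 := (Finset.sum_eq_zero_iff_of_nonneg fun r _ => mul_nonneg hh.le (hterm r)).1
      (le_antisymm hzero (Finset.sum_nonneg fun r _ => mul_nonneg hh.le (hterm r))) r
      (Finset.mem_univ r)
    have h2 := (mul_eq_zero.1 h1).resolve_left hh.ne'
    have h3 := (mul_eq_zero.1 h2).resolve_left (inv_ne_zero hn'.ne')
    have h4 := (Finset.sum_eq_zero_iff_of_nonneg fun i _ => sq_nonneg _).1 h3 i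
      (Finset.mem_univ i)
    exact sub_eq_zero.1 (l2_eq_zero.1 (pow_eq_zero_iff two_ne_zero |>.1 h4))
  set W : Matrix (Fin n × Fin d) (Fin d) ℝ := Matrix.of fun r => mean (z r) with hW
  have hRW : R = W * (stack Y)ᵀ := by
    ext r ⟨i, a⟩
    have := congrFun (hYz r i) a
    rw [hz0] at this
    rw [Matrix.mul_apply]
    refine this.symm.trans ?_
    simp [mulVec, dotProduct, hW, stack, mul_comm]
  have hG' : Rᵀ * R = stack Y * ((Wᵀ * W) * (stack Y)ᵀ) := by
    conv_lhs => rw [hRW]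
    rw [transpose_mul, transpose_transpose]; simp only [Matrix.mul_assoc]
  have hWW : Wᵀ * W = 1 := by
    have h1 : Y ⟨0, hn⟩ * ((Wᵀ * W) * (Y ⟨0, hn⟩)ᵀ) = 1 := by
      have := hG.2 ⟨0, hn⟩
      rw [hG'] at this
      exact this
    have h2 := mul_eq_one_comm.1 h1
    rwa [Matrix.mul_assoc, hY, Matrix.mul_one] at h2
  exact hne (by rw [hG', hWW, Matrix.one_mul])

end

variable {n d m : ℕ}

/-! ### The small noise regime -/

/-- The noise level of the theorem, for a matrix `A` with singular values in `[s, κ s]` and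
perturbations of size at most `x ‖A‖`. -/
structure SmallNoise (A : Matrix (Fin d) (Fin m) ℝ) (Δ : Fin n → Matrix (Fin d) (Fin m) ℝ)
    (s κ x : ℝ) : Prop where
  s_pos : 0 < s
  one_le : 1 ≤ κ
  x_nonneg : 0 ≤ x
  small : κ ^ 4 * x ≤ 1 / 192
  norm_eq : ‖A‖ = κ * s
  noise : ∀ i, ‖Δ i‖ ≤ κ * s * x
  low : ∀ u, s * l2 u ≤ l2 (Aᵀ *ᵥ u)

namespace SmallNoise

variable {A : Matrix (Fin d) (Fin m) ℝ} {Δ : Fin n → Matrix (Fin d) (Fin m) ℝ} {s κ x : ℝ}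

lemma pow_mul_le (h : SmallNoise A Δ s κ x) {j : ℕ} (hj : j ≤ 4) : κ ^ j * x ≤ 1 / 192 :=
  (mul_le_mul_of_nonneg_right (pow_le_pow_right₀ h.one_le hj) h.x_nonneg).trans h.small

/-- If the mean of the blocks is within `γ ≤ 1 / (16 κ²)` of an orthogonal `Q`, then `corr` is
close to `Aᵀ Q`, even after multiplication by `κ`. -/
lemma norm_corr_sub_le (h : SmallNoise A Δ s κ x) (hn : 0 < n)
    {S : Fin n → Matrix (Fin d) (Fin d) ℝ} (hS : ∀ i, (S i)ᵀ * S i = 1)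
    {Q : Matrix (Fin d) (Fin d) ℝ} {γ : ℝ} (hγ : κ ^ 2 * γ ≤ 1 / 16) (hSQ : ‖mean S - Q‖ ≤ γ) :
    ‖corr (fun i => A + Δ i) S - Aᵀ * Q‖ ≤ 13 / 192 * s / κ := by
  have hκ := h.one_le
  have hs := h.s_pos
  refine (Procrustes.norm_corr_sub_le hn h.noise hS hSQ).trans ?_
  rw [h.norm_eq, le_div_iff₀ (by linarith)]
  have h2 := h.pow_mul_le (j := 2) (by norm_num)
  calc (κ * s * γ + κ * s * x) * κ = s * (κ ^ 2 * γ + κ ^ 2 * x) := by ring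
    _ ≤ s * (1 / 16 + 1 / 192) := by gcongr
    _ = _ := by ring

/-- If the mean of the blocks is close to an orthogonal matrix, then `B * corr` is bounded below by a
multiple of `σ_min²`, for every `B` near `A`. -/
lemma l2_corr_ge (h : SmallNoise A Δ s κ x) (hn : 0 < n)
    {S : Fin n → Matrix (Fin d) (Fin d) ℝ} (hS : ∀ i, (S i)ᵀ * S i = 1)
    {Q : Matrix (Fin d) (Fin d) ℝ} (hQ : Qᵀ * Q = 1) {γ : ℝ} (hγ : κ ^ 2 * γ ≤ 1 / 16)
    (hSQ : ‖mean S - Q‖ ≤ γ) {B : Matrix (Fin d) (Fin m) ℝ} {b : ℝ} (hB : ‖B - A‖ ≤ b * s)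
    (u : Fin d → ℝ) :
    (179 / 192 - 205 / 192 * (κ * b)) * s ^ 2 * l2 u
      ≤ l2 ((B * corr (fun i => A + Δ i) S) *ᵥ u) := by
  have hκ := h.one_le
  have hκ0 : 0 < κ := by linarith
  have hs := h.s_pos
  have hb : 0 ≤ b * s := (norm_nonneg _).trans hB
  refine le_trans ?_ (l2_mul_mulVec_ge hs.le h.low hQ (h.norm_corr_sub_le hn hS hγ hSQ) hB u)
  refine mul_le_mul_of_nonneg_right ?_ (l2_nonneg u)
  have h1 : κ * s * (13 / 192 * s / κ) = 13 / 192 * s ^ 2 := by field_simp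
  have h2 : 13 / 192 * s / κ ≤ 13 / 192 * (κ * s) := by
    rw [div_le_iff₀ hκ0]
    have : s * 1 ≤ s * (κ * κ) := by gcongr; nlinarith
    linarith
  have h3 := mul_le_mul_of_nonneg_left h2 hb
  rw [h.norm_eq, h1]
  linarith

/-- One step maps into a tube of radius of order `κ² x`. -/
lemma norm_step_sub_le [Nonempty (Fin d)] (h : SmallNoise A Δ s κ x) (hn : 0 < n)
    {S : Fin n → Matrix (Fin d) (Fin d) ℝ} (hS : ∀ i, (S i)ᵀ * S i = 1)
    {Q : Matrix (Fin d) (Fin d) ℝ} (hQ : Qᵀ * Q = 1) {γ : ℝ} (hγ : κ ^ 2 * γ ≤ 1 / 16)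
    (hSQ : ‖mean S - Q‖ ≤ γ) {P R : Matrix (Fin d) (Fin d) ℝ} {i : Fin n}
    (hP : IsPolar (A * corr (fun i => A + Δ i) S) P)
    (hR : IsPolar ((A + Δ i) * corr (fun i => A + Δ i) S) R) : ‖R - P‖ ≤ 7 / 3 * κ ^ 2 * x := by
  have hκ := h.one_le
  have hκ0 : 0 < κ := by linarith
  have hs := h.s_pos
  have hM : ‖corr (fun i => A + Δ i) S‖ ≤ 205 / 192 * (κ * s) := by
    have e : corr (fun i => A + Δ i) S = Aᵀ * Q + (corr (fun i => A + Δ i) S - Aᵀ * Q) := by abel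
    rw [e]
    have h1 := h.norm_corr_sub_le hn hS hγ hSQ
    have h2 : ‖Aᵀ * Q‖ ≤ κ * s := by
      refine (norm_mul_le' _ _).trans ?_
      rw [norm_transpose, h.norm_eq]
      exact mul_le_of_le_one_right (by positivity) (norm_ortho_le hQ)
    have h3 : 13 / 192 * s / κ ≤ 13 / 192 * (κ * s) := by
      rw [div_le_iff₀ hκ0]
      have : s * 1 ≤ s * (κ * κ) := by gcongr; nlinarith
      linarith
    refine (norm_add_le _ _).trans ?_
    linarith
  have hlow := h.l2_corr_ge hn hS hQ hγ hSQ (B := A) (b := 0) (by simp)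
  refine (Procrustes.norm_step_sub_le hP hR (k := (179 / 192 - 205 / 192 * (κ * 0)) * s ^ 2)
    (by rw [mul_zero]; positivity) hlow (h.noise i) hM).trans ?_
  have hx := h.x_nonneg
  have e : 2 * (κ * s * x * (205 / 192 * (κ * s)) / ((179 / 192 - 205 / 192 * (κ * 0)) * s ^ 2))
      = 410 / 179 * κ ^ 2 * x := by
    field_simp; ring
  rw [e]
  have : 0 ≤ κ ^ 2 * x := by positivity
  linarith

/-- There is a fixed point all of whose blocks are within `O(κ x)` of the identity. -/
lemma exists_fixedPoint [Nonempty (Fin d)] (h : SmallNoise A Δ s κ x) (hn : 0 < n) :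
    ∃ Y : Fin n → Matrix (Fin d) (Fin d) ℝ,
      (∀ i, IsPolar ((A + Δ i) * corr (fun i => A + Δ i) Y) (Y i)) ∧
      ∀ i, ‖Y i - 1‖ ≤ 21 / 10 * κ * x := by
  have hκ := h.one_le
  have hκ0 : 0 < κ := by linarith
  have hs := h.s_pos
  have hx := h.x_nonneg
  set τ := 7 / 3 * κ ^ 2 * x with hτ
  have hτ0 : 0 ≤ τ := by positivity
  have hτγ : κ ^ 2 * τ ≤ 1 / 16 := by
    have := h.small
    rw [hτ]; nlinarith
  have hmean : ∀ {S : Fin n → Matrix (Fin d) (Fin d) ℝ} {Q : Matrix (Fin d) (Fin d) ℝ},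
      (∀ i, ‖S i - Q‖ ≤ τ) → ‖mean S - Q‖ ≤ τ := fun {S Q} hSQ => by
    refine norm_mean_sub_le hn hτ0 ((mean_mono fun i => ?_).trans (mean_const hn _).le)
    exact pow_le_pow_left₀ (norm_nonneg _) (hSQ i) 2
  obtain ⟨S, ⟨hS, Q, hQ, hSQ⟩, hfix⟩ := exists_fixedPoint_of_mapsTo hn (fun i => A + Δ i) hτ0
    (fun S hS T hT => by
      obtain ⟨hS, Q, hQ, hSQ⟩ := hS
      obtain ⟨P, hP⟩ := exists_isPolar (A * corr (fun i => A + Δ i) S)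
      exact ⟨fun i => (hT i).ortho, P, hP.ortho, fun i =>
        h.norm_step_sub_le hn hS hQ hτγ (hmean hSQ) hP (hT i)⟩)
  obtain ⟨P, hP⟩ := exists_isPolar (A * corr (fun i => A + Δ i) S)
  have hPt := ortho_transpose hP.ortho
  have hPP : P * Pᵀ = 1 := mul_eq_one_comm.1 hP.ortho
  have hSP : ∀ i, ‖S i - P‖ ≤ τ := fun i =>
    h.norm_step_sub_le hn hS hQ hτγ (hmean hSQ) hP (hfix i)
  -- pass to the gauge in which the polar factor of `A * corr` is the identity
  set Y : Fin n → Matrix (Fin d) (Fin d) ℝ := fun i => S i * Pᵀ with hYdef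
  have hcorr : corr (fun i => A + Δ i) Y = corr (fun i => A + Δ i) S * Pᵀ := corr_mul _ _ _
  have hYfix : ∀ i, IsPolar ((A + Δ i) * corr (fun i => A + Δ i) Y) (Y i) := fun i => by
    rw [hcorr, ← Matrix.mul_assoc]; exact (hfix i).mul_right hPt
  have hYτ : ∀ i, ‖Y i - 1‖ ≤ τ := fun i => by
    have : Y i - 1 = (S i - P) * Pᵀ := by rw [Matrix.sub_mul, hPP]
    rw [this]
    exact (norm_mul_le' _ _).trans
      ((mul_le_of_le_one_right (norm_nonneg _) (norm_ortho_le hPt)).trans (hSP i))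
  refine ⟨Y, hYfix, fun i => ?_⟩
  have hgauge : IsPolar (A * corr (fun i => A + Δ i) Y) 1 := by
    rw [hcorr, ← Matrix.mul_assoc, ← hPP]; exact hP.mul_right hPt
  have hdist := Procrustes.norm_corr_sub_le hn (A := A) h.noise (fun i => (hYfix i).ortho)
    (hmean hYτ)
  rw [Matrix.mul_one, h.norm_eq] at hdist
  have h3 := h.pow_mul_le (j := 3) (by norm_num)
  have h1 := h.pow_mul_le (j := 1) (by norm_num)
  have hsum : κ * s * τ + κ * s * x ≤ 1 / 50 * s := by
    rw [hτ]; nlinarith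
  have hlow : ∀ u, 49 / 50 * s * l2 u ≤ l2 (corr (fun i => A + Δ i) Y *ᵥ u) := fun u => by
    have e : corr (fun i => A + Δ i) Y *ᵥ u
        = Aᵀ *ᵥ u + (corr (fun i => A + Δ i) Y - Aᵀ) *ᵥ u := by rw [sub_mulVec]; abel
    have b1 := (l2_mulVec_le (corr (fun i => A + Δ i) Y - Aᵀ) u).trans
      (mul_le_mul_of_nonneg_right (hdist.trans hsum) (l2_nonneg u))
    have b2 := l2_sub_le (corr (fun i => A + Δ i) Y *ᵥ u)
      ((corr (fun i => A + Δ i) Y - Aᵀ) *ᵥ u)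
    have b3 : corr (fun i => A + Δ i) Y *ᵥ u - (corr (fun i => A + Δ i) Y - Aᵀ) *ᵥ u
        = Aᵀ *ᵥ u := by rw [sub_mulVec]; abel
    rw [b3] at b2
    have := h.low u
    linarith
  refine (norm_fixedPoint_sub_one_le hn h.noise hYτ hYfix hgauge
    (r := 49 / 50 * s) (θ := 1 / 40) (by positivity) hlow ?_ (by norm_num) i).trans ?_
  · rw [h.norm_eq]
    have e : κ * s * x + τ * (κ * s) = κ * s * τ + κ * s * x := by ring
    rw [e]
    linarith
  · have e : 2 * (κ * s * x / (49 / 50 * s * (1 - 1 / 40))) = 4000 / 1911 * κ * x := by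
      field_simp; ring
    rw [e]
    have : 0 ≤ κ * x := by positivity
    linarith

section FixedPoint

variable {Y : Fin n → Matrix (Fin d) (Fin d) ℝ}

lemma mean_transpose_mul_eq (Y : Fin n → Matrix (Fin d) (Fin d) ℝ)
    (A : Fin n → Matrix (Fin d) (Fin m) ℝ) :
    mean (fun i => (Y i)ᵀ * A i) = (corr A Y)ᵀ := by
  rw [corr, transpose_mean]
  simp only [transpose_mul, transpose_transpose]

/-- The data rotated back by the fixed point are close to `A`.  In the lemmas that follow, `A` is
replaced by the mean of the rotated data, which inherits its bounds. -/
lemma norm_rotated_sub_le (h : SmallNoise A Δ s κ x) (hY : ∀ i, (Y i)ᵀ * Y i = 1)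
    (hY1 : ∀ i, ‖Y i - 1‖ ≤ 21 / 10 * κ * x) (i : Fin n) :
    ‖(Y i)ᵀ * (A + Δ i) - A‖ ≤ 31 / 10 * (κ ^ 2 * x) * s := by
  have hκ := h.one_le
  have hs := h.s_pos
  have hx := h.x_nonneg
  have e : (Y i)ᵀ * (A + Δ i) - A = (Y i)ᵀ * (Δ i - (Y i - 1) * A) := by
    rw [Matrix.mul_sub, ← Matrix.mul_assoc, mul_sub, hY i, Matrix.mul_add, Matrix.sub_mul,
      Matrix.mul_one, Matrix.one_mul]
    abel
  rw [e]
  refine (norm_mul_le' _ _).trans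
    ((mul_le_of_le_one_left (norm_nonneg _) (norm_ortho_le (ortho_transpose (hY i)))).trans ?_)
  refine (norm_sub_le _ _).trans ((add_le_add (h.noise i) ((norm_mul_le' _ _).trans
    (mul_le_mul_of_nonneg_right (hY1 i) (norm_nonneg _)))).trans ?_)
  rw [h.norm_eq]
  have : κ * s * x * 1 ≤ κ * s * x * κ := by gcongr
  linarith

lemma norm_mean_rotated_sub_le (h : SmallNoise A Δ s κ x) (hn : 0 < n)
    (hY : ∀ i, (Y i)ᵀ * Y i = 1) (hY1 : ∀ i, ‖Y i - 1‖ ≤ 21 / 10 * κ * x) :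
    ‖mean (fun i => (Y i)ᵀ * (A + Δ i)) - A‖ ≤ 31 / 10 * (κ ^ 2 * x) * s := by
  have : mean (fun i => (Y i)ᵀ * (A + Δ i)) - A = mean fun i => (Y i)ᵀ * (A + Δ i) - A := by
    rw [mean_sub, mean_const hn]
  rw [this]
  exact (norm_mean_le _).trans
    ((mean_mono fun i => h.norm_rotated_sub_le hY hY1 i).trans (mean_const hn _).le)

lemma norm_rotated_sub_mean_le (h : SmallNoise A Δ s κ x) (hn : 0 < n)
    (hY : ∀ i, (Y i)ᵀ * Y i = 1) (hY1 : ∀ i, ‖Y i - 1‖ ≤ 21 / 10 * κ * x) (i : Fin n) :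
    ‖(Y i)ᵀ * (A + Δ i) - mean (fun i => (Y i)ᵀ * (A + Δ i))‖ ≤ 31 / 5 * (κ ^ 2 * x) * s := by
  have h1 := h.norm_rotated_sub_le hY hY1 i
  have h2 := h.norm_mean_rotated_sub_le hn hY hY1
  have h3 := norm_sub_le ((Y i)ᵀ * (A + Δ i) - A) (mean (fun i => (Y i)ᵀ * (A + Δ i)) - A)
  rw [sub_sub_sub_cancel_right] at h3
  linarith

lemma norm_mean_rotated_le (h : SmallNoise A Δ s κ x) (hn : 0 < n)
    (hY : ∀ i, (Y i)ᵀ * Y i = 1) (hY1 : ∀ i, ‖Y i - 1‖ ≤ 21 / 10 * κ * x) :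
    ‖mean (fun i => (Y i)ᵀ * (A + Δ i))‖ ≤ 51 / 50 * (κ * s) := by
  have hκ := h.one_le
  have hs := h.s_pos
  have h1 := h.norm_mean_rotated_sub_le hn hY hY1
  have h2 := norm_add_le (mean (fun i => (Y i)ᵀ * (A + Δ i)) - A) A
  rw [sub_add_cancel, h.norm_eq] at h2
  have h3 := mul_le_mul_of_nonneg_right (h.pow_mul_le (j := 2) (by norm_num)) hs.le
  have h4 : 1 * s ≤ κ * s := by gcongr
  linarith

lemma l2_mean_rotated_ge (h : SmallNoise A Δ s κ x) (hn : 0 < n)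
    (hY : ∀ i, (Y i)ᵀ * Y i = 1) (hY1 : ∀ i, ‖Y i - 1‖ ≤ 21 / 10 * κ * x) (u : Fin d → ℝ) :
    49 / 50 * s * l2 u ≤ l2 ((mean fun i => (Y i)ᵀ * (A + Δ i))ᵀ *ᵥ u) := by
  have hs := h.s_pos
  have h1 := h.norm_mean_rotated_sub_le hn hY hY1
  rw [← norm_transpose, transpose_sub] at h1
  have h3 := mul_le_mul_of_nonneg_right (h.pow_mul_le (j := 2) (by norm_num)) hs.le
  have h2 := (l2_mulVec_le ((mean fun i => (Y i)ᵀ * (A + Δ i))ᵀ - Aᵀ) u).trans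
    (mul_le_mul_of_nonneg_right (b := ‖_‖) (c := 1 / 50 * s) (by linarith) (l2_nonneg u))
  have h4 := l2_sub_le ((mean fun i => (Y i)ᵀ * (A + Δ i))ᵀ *ᵥ u)
    (((mean fun i => (Y i)ᵀ * (A + Δ i))ᵀ - Aᵀ) *ᵥ u)
  have e : (mean fun i => (Y i)ᵀ * (A + Δ i))ᵀ *ᵥ u
      - ((mean fun i => (Y i)ᵀ * (A + Δ i))ᵀ - Aᵀ) *ᵥ u = Aᵀ *ᵥ u := by
    rw [sub_mulVec]; abel
  rw [e] at h4
  have := h.low u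
  linarith

/-- The fixed-point equation in terms of the rotated data. -/
lemma rotated_symm
    (hfix : ∀ i, IsPolar ((A + Δ i) * corr (fun i => A + Δ i) Y) (Y i)) (i : Fin n) :
    (((Y i)ᵀ * (A + Δ i)) * (mean fun i => (Y i)ᵀ * (A + Δ i))ᵀ)ᵀ
      = ((Y i)ᵀ * (A + Δ i)) * (mean fun i => (Y i)ᵀ * (A + Δ i))ᵀ := by
  rw [mean_transpose_mul_eq, transpose_transpose, Matrix.mul_assoc]
  exact (hfix i).symm

lemma norm_mean_fixedPoint_sub_one_le (h : SmallNoise A Δ s κ x) (hn : 0 < n)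
    (hY1 : ∀ i, ‖Y i - 1‖ ≤ 21 / 10 * κ * x) : ‖mean Y - 1‖ ≤ 21 / 10 * κ * x := by
  have hκ := h.one_le
  have hx := h.x_nonneg
  exact norm_mean_sub_le hn (by positivity) ((mean_mono fun i =>
    pow_le_pow_left₀ (norm_nonneg _) (hY1 i) 2).trans (mean_const hn _).le)

/-- At the fixed point the step is single-valued. -/
lemma fixedPoint_unique (h : SmallNoise A Δ s κ x) (hn : 0 < n)
    (hfix : ∀ i, IsPolar ((A + Δ i) * corr (fun i => A + Δ i) Y) (Y i))
    (hY1 : ∀ i, ‖Y i - 1‖ ≤ 21 / 10 * κ * x) {i : Fin n} {R : Matrix (Fin d) (Fin d) ℝ}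
    (hR : IsPolar ((A + Δ i) * corr (fun i => A + Δ i) Y) R) : R = Y i := by
  have hκ := h.one_le
  have hs := h.s_pos
  have h3 := h.pow_mul_le (j := 3) (by norm_num)
  have h2 := h.pow_mul_le (j := 2) (by norm_num)
  have hlow := h.l2_corr_ge hn (fun i => (hfix i).ortho) (Q := 1) (by simp)
    (γ := 21 / 10 * κ * x) (by linarith) (h.norm_mean_fixedPoint_sub_one_le hn hY1)
    (B := A + Δ i) (b := κ * x) (by
      rw [add_sub_cancel_left]; exact (h.noise i).trans (le_of_eq (by ring)))
  refine (hfix i).unique hR (mul_pos ?_ (pow_pos hs 2)) ((hfix i).le_of_l2_le hlow)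
  nlinarith

lemma isUniqueSDPMaximizer (h : SmallNoise A Δ s κ x) (hn : 0 < n)
    (hfix : ∀ i, IsPolar ((A + Δ i) * corr (fun i => A + Δ i) Y) (Y i))
    (hY1 : ∀ i, ‖Y i - 1‖ ≤ 21 / 10 * κ * x) :
    IsUniqueSDPMaximizer (dataC A Δ) (stack Y * (stack Y)ᵀ) := by
  have hκ := h.one_le
  have hs := h.s_pos
  have hx := h.x_nonneg
  have hY := fun i => (hfix i).ortho
  have h3 := h.pow_mul_le (j := 3) (by norm_num)
  have h2 := h.pow_mul_le (j := 2) (by norm_num)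
  have hx2 : 0 ≤ κ ^ 2 * x := by positivity
  refine isUniqueSDPMaximizer_of_fixedPoint hn hY (h := (49 / 50 * s) ^ 2
    - 31 / 5 * (κ ^ 2 * x) * s * (51 / 50 * (κ * s)) - (31 / 5 * (κ ^ 2 * x) * s) ^ 2) ?_
    fun z => ?_
  · have e : (49 / 50 * s) ^ 2 - 31 / 5 * (κ ^ 2 * x) * s * (51 / 50 * (κ * s))
        - (31 / 5 * (κ ^ 2 * x) * s) ^ 2
        = s ^ 2 * ((49 / 50) ^ 2 - 31 / 5 * (51 / 50) * (κ ^ 3 * x)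
          - (31 / 5) ^ 2 * (κ ^ 2 * x) ^ 2) := by ring
    rw [e]
    refine mul_pos (pow_pos hs 2) ?_
    nlinarith
  · refine (mean_sq_sub_mean_le hn (rotated_symm hfix)
      (h.norm_rotated_sub_mean_le hn hY hY1) (h.norm_mean_rotated_le hn hY hY1)
      (by positivity) (h.l2_mean_rotated_ge hn hY hY1) z).trans (le_of_eq ?_)
    simp only [mean_transpose_mul_eq, transpose_transpose, Matrix.mul_assoc]

/-- One step contracts the distance to the fixed point, at a rate controlled by the spread `t` of
the blocks around a common orthogonal matrix. -/
lemma dF_step_le (h : SmallNoise A Δ s κ x) (hn : 0 < n)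
    (hfix : ∀ i, IsPolar ((A + Δ i) * corr (fun i => A + Δ i) Y) (Y i))
    (hY1 : ∀ i, ‖Y i - 1‖ ≤ 21 / 10 * κ * x)
    {S T : Matrix (Fin n × Fin d) (Fin d) ℝ} (hS : IsOrthStack S)
    (hstep : IsGPMStep (dataC A Δ) S T) {Q₁ : Matrix (Fin d) (Fin d) ℝ} (hQ₁ : Q₁ᵀ * Q₁ = 1)
    {t : ℝ} (ht : 0 ≤ t) (htκ : κ ^ 2 * t ≤ 1 / 16)
    (hSt : mean (fun i => ‖block S i - Q₁‖ ^ 2) ≤ t ^ 2) :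
    dF T (stack Y) ≤ (t / 2 + 3 * κ * x) * dF S (stack Y) := by
  have hκ := h.one_le
  have hs := h.s_pos
  have hx := h.x_nonneg
  have hn' : (0 : ℝ) < n := by exact_mod_cast hn
  have hY := fun i => (hfix i).ortho
  rw [isGPMStep_iff hn] at hstep
  rw [isOrthStack_iff] at hS
  obtain ⟨Q₀, hQ₀, hdF⟩ := exists_dF_eq hn S (Y := stack Y) (isOrthStack_iff.2 hY)
  rw [block_stack] at hQ₀
  have hQ₀t := ortho_transpose hQ₀.ortho
  have hQQ : Q₀ * Q₀ᵀ = 1 := mul_eq_one_comm.1 hQ₀.ortho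
  set B : Fin n → Matrix (Fin d) (Fin m) ℝ := fun i => (Y i)ᵀ * (A + Δ i) with hB
  set V : Fin n → Matrix (Fin d) (Fin d) ℝ := fun i => (Y i)ᵀ * block S i * Q₀ᵀ with hV
  have hVorth : ∀ i, (V i)ᵀ * V i = 1 := fun i =>
    ortho_mul (ortho_mul (ortho_transpose (hY i)) (hS i)) hQ₀t
  have hpolV : IsPolar (mean V) 1 := by
    rw [← hQQ, hV, ← mean_mul]; exact hQ₀.mul_right hQ₀t
  have hsymm : (mean V)ᵀ = mean V := by
    have := hpolV.symm; rwa [transpose_one, Matrix.one_mul] at this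
  have hpsd : ∀ u, 0 ≤ u ⬝ᵥ mean V *ᵥ u := fun u => by
    have := hpolV.nonneg u; rwa [transpose_one, Matrix.one_mul] at this
  have hVt : mean (fun i => ‖V i - Q₁ * Q₀ᵀ‖ ^ 2) ≤ (t + 21 / 10 * κ * x) ^ 2 := by
    refine (mean_mono fun i => ?_).trans (mean_add_sq_le hn ht (by positivity) hSt)
    refine pow_le_pow_left₀ (norm_nonneg _) ?_ 2
    have e : V i - Q₁ * Q₀ᵀ = ((Y i)ᵀ * ((block S i - Q₁) - (Y i - 1) * Q₁)) * Q₀ᵀ := by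
      have e' : (Y i)ᵀ * ((block S i - Q₁) - (Y i - 1) * Q₁) = (Y i)ᵀ * block S i - Q₁ := by
        rw [Matrix.sub_mul, Matrix.one_mul, sub_sub_sub_cancel_right, Matrix.mul_sub,
          ← Matrix.mul_assoc _ (Y i) Q₁, hY i, Matrix.one_mul]
      rw [e', Matrix.sub_mul]
    rw [e]
    refine (norm_mul_le' _ _).trans
      ((mul_le_of_le_one_right (norm_nonneg _) (norm_ortho_le hQ₀t)).trans ?_)
    refine (norm_mul_le' _ _).trans
      ((mul_le_of_le_one_left (norm_nonneg _) (norm_ortho_le (ortho_transpose (hY i)))).trans ?_)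
    refine (norm_sub_le _ _).trans (add_le_add le_rfl ?_)
    exact (norm_mul_le' _ _).trans
      ((mul_le_of_le_one_right (norm_nonneg _) (norm_ortho_le hQ₁)).trans (hY1 i))
  have hblk : ∀ i, block S i - Y i * Q₀ = Y i * ((V i - 1) * Q₀) := fun i => by
    have : V i * Q₀ = (Y i)ᵀ * block S i := by
      rw [hV]; simp only [Matrix.mul_assoc, hQ₀.ortho, Matrix.mul_one]
    rw [Matrix.sub_mul, this, Matrix.one_mul, Matrix.mul_sub, ← Matrix.mul_assoc,
      mul_eq_one_comm.1 (hY i), Matrix.one_mul]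
  obtain ⟨w, hw⟩ : ∃ w, w = √(mean fun i => frob (V i - 1) ^ 2) := ⟨_, rfl⟩
  have hw0 : 0 ≤ w := by rw [hw]; exact Real.sqrt_nonneg _
  have hw2 : w ^ 2 = mean fun i => frob (V i - 1) ^ 2 := by
    rw [hw]; exact Real.sq_sqrt (mean_nonneg fun i => sq_nonneg _)
  have hdFw : dF S (stack Y) = √n * w := by
    rw [hdF, ← sq_eq_sq₀ (frob_nonneg _) (by positivity), mul_pow, Real.sq_sqrt hn'.le, hw2,
      frob_sq_eq_mean hn]
    congr 2; ext1 i
    rw [block_sub_mul, block_stack, hblk, frob_ortho_mul (hY i), frob_mul_ortho hQ₀.ortho]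
  have hcorr : corr B V = corr (fun i => A + Δ i) (block S) * Q₀ᵀ := by
    rw [← corr_mul]
    simp only [corr]
    congr 1; ext1 i
    simp only [hB, hV]
    rw [transpose_mul, transpose_transpose, Matrix.mul_assoc, Matrix.mul_assoc (Y i)ᵀ,
      ← Matrix.mul_assoc (Y i), mul_eq_one_comm.1 (hY i), Matrix.one_mul]
  have hmeanS := norm_mean_sub_le hn ht hSt
  have h4 := h.small
  have h3 := h.pow_mul_le (j := 3) (by norm_num)
  have h2 := h.pow_mul_le (j := 2) (by norm_num)
  have hk : ∀ u, (179 / 192 - 205 / 192 * (κ * (31 / 10 * (κ ^ 2 * x)))) * s ^ 2 * l2 u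
      ≤ l2 ((mean B * corr B V) *ᵥ u) := fun u => by
    have := h.l2_corr_ge hn hS hQ₁ htκ hmeanS (h.norm_mean_rotated_sub_le hn hY hY1) (Q₀ᵀ *ᵥ u)
    rwa [l2_ortho_mulVec hQ₀t, mulVec_mulVec, Matrix.mul_assoc, ← hcorr] at this
  have hk2 : 22 / 25 * s ^ 2 ≤ (179 / 192 - 205 / 192 * (κ * (31 / 10 * (κ ^ 2 * x)))) * s ^ 2
      - 31 / 5 * (κ ^ 2 * x) * s * (51 / 50 * (κ * s)) := by
    have e : (179 / 192 - 205 / 192 * (κ * (31 / 10 * (κ ^ 2 * x)))) * s ^ 2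
      - 31 / 5 * (κ ^ 2 * x) * s * (51 / 50 * (κ * s)) = s ^ 2 * (179 / 192
        - (205 / 192 * (31 / 10) + 31 / 5 * (51 / 50)) * (κ ^ 3 * x)) := by ring
    rw [e, mul_comm]
    refine mul_le_mul_of_nonneg_left ?_ (sq_nonneg s)
    linarith
  have hk0 : 0 < 22 / 25 * s ^ 2 := by positivity
  have hR : ∀ i, IsPolar (B i * corr B V) ((Y i)ᵀ * block T i * Q₀ᵀ) := fun i => by
    have := ((hstep i).mul_left (ortho_transpose (hY i))).mul_right hQ₀t
    rwa [← Matrix.mul_assoc (Y i)ᵀ, Matrix.mul_assoc ((Y i)ᵀ * (A + Δ i)), ← hcorr] at this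
  obtain ⟨Q, hQ, hRQ⟩ := exists_frob_step_sub_le hn (rotated_symm hfix)
    (h.norm_rotated_sub_mean_le hn hY hY1) (h.norm_mean_rotated_le hn hY hY1)
    (by positivity) (h.l2_mean_rotated_ge hn hY hY1) hVorth hsymm hpsd (by positivity) hw0
    hVt hw2.ge hk (hk0.trans_le hk2) hR
  -- the rate: two factors `κ² x s` and `κ s (t + κ x)` over the least eigenvalue `s²`
  have hrate : 2 * (31 / 5 * (κ ^ 2 * x) * s * (1 + 2 * (51 / 50 * (κ * s)) / (49 / 50 * s))
      * ((2 * (51 / 50 * (κ * s)) * (t + 21 / 10 * κ * x) + 31 / 5 * (κ ^ 2 * x) * s) * w))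
      / ((179 / 192 - 205 / 192 * (κ * (31 / 10 * (κ ^ 2 * x)))) * s ^ 2
        - 31 / 5 * (κ ^ 2 * x) * s * (51 / 50 * (κ * s))) ≤ (t / 2 + 3 * κ * x) * w := by
    rw [div_le_iff₀ (hk0.trans_le hk2)]
    refine le_trans ?_ (mul_le_mul_of_nonneg_left hk2 (by positivity))
    have b1 : 1 + 2 * (51 / 50 * (κ * s)) / (49 / 50 * s) ≤ 31 / 10 * κ := by
      have : 2 * (51 / 50 * (κ * s)) / (49 / 50 * s) = 102 / 49 * κ := by field_simp; norm_num
      rw [this]; linarith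
    have b2 : 2 * (51 / 50 * (κ * s)) * (t + 21 / 10 * κ * x) + 31 / 5 * (κ ^ 2 * x) * s
        ≤ κ * s * (51 / 25 * t + 21 / 2 * κ * x) := by
      have : 0 ≤ κ ^ 2 * s * x := by positivity
      linarith
    calc 2 * (31 / 5 * (κ ^ 2 * x) * s * (1 + 2 * (51 / 50 * (κ * s)) / (49 / 50 * s))
          * ((2 * (51 / 50 * (κ * s)) * (t + 21 / 10 * κ * x) + 31 / 5 * (κ ^ 2 * x) * s) * w))
        ≤ 2 * (31 / 5 * (κ ^ 2 * x) * s * (31 / 10 * κ)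
          * ((κ * s * (51 / 25 * t + 21 / 2 * κ * x)) * w)) := by gcongr
      _ = 961 / 25 * (κ ^ 4 * x) * ((51 / 25 * t + 21 / 2 * κ * x) * w * s ^ 2) := by ring
      _ ≤ 961 / 25 * (1 / 192) * ((51 / 25 * t + 21 / 2 * κ * x) * w * s ^ 2) := by gcongr
      _ ≤ (t / 2 + 3 * κ * x) * w * (22 / 25 * s ^ 2) := by
          have a1 : 0 ≤ t * w * s ^ 2 := by positivity
          have a2 : 0 ≤ κ * x * w * s ^ 2 := by positivity
          linarith
  refine (dF_le (ortho_mul hQ hQ₀.ortho)).trans ?_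
  rw [hdFw]
  refine le_of_sq_le_sq ?_ (by positivity)
  rw [frob_sq_eq_mean hn]
  have e : ((t / 2 + 3 * κ * x) * (√n * w)) ^ 2 = n * ((t / 2 + 3 * κ * x) * w) ^ 2 := by
    rw [mul_pow, mul_pow (√n), Real.sq_sqrt hn'.le]; ring
  rw [e]
  refine mul_le_mul_of_nonneg_left ?_ hn'.le
  refine (mean_mono fun i => ?_).trans (mean_const hn _).le
  have e2 : block (T - stack Y * (Q * Q₀)) i
      = Y i * (((Y i)ᵀ * block T i * Q₀ᵀ - Q) * Q₀) := by
    rw [block_sub_mul, block_stack, Matrix.sub_mul, Matrix.mul_assoc _ Q₀ᵀ, hQ₀.ortho,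
      Matrix.mul_one, Matrix.mul_sub, ← Matrix.mul_assoc (Y i) Q, ← Matrix.mul_assoc (Y i) (Y i)ᵀ,
      mul_eq_one_comm.1 (hY i), Matrix.one_mul]
  rw [e2, frob_ortho_mul (hY i), frob_mul_ortho hQ₀.ortho]
  exact pow_le_pow_left₀ (frob_nonneg _) ((hRQ i).trans hrate) 2

/-- Linear convergence of every run that starts with spread at most `t`: after the first step the
spread is `O(κ² x)`, whatever the start. -/
lemma dF_run_le [Nonempty (Fin d)] (h : SmallNoise A Δ s κ x) (hn : 0 < n)
    (hfix : ∀ i, IsPolar ((A + Δ i) * corr (fun i => A + Δ i) Y) (Y i))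
    (hY1 : ∀ i, ‖Y i - 1‖ ≤ 21 / 10 * κ * x)
    {S : ℕ → Matrix (Fin n × Fin d) (Fin d) ℝ} (hS : IsOrthStack (S 0))
    (hrun : IsGPM (dataC A Δ) S) {Q₁ : Matrix (Fin d) (Fin d) ℝ} (hQ₁ : Q₁ᵀ * Q₁ = 1)
    {t : ℝ} (ht : 0 ≤ t) (htκ : κ ^ 2 * t ≤ 1 / 16)
    (hSt : mean (fun i => ‖block (S 0) i - Q₁‖ ^ 2) ≤ t ^ 2) (N : ℕ) :
    IsOrthStack (S N) ∧
      dF (S N) (stack Y) ≤ (8 * κ ^ 2 * t + 12 * κ ^ 2 * x) ^ N * dF (S 0) (stack Y) := by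
  have hκ := h.one_le
  have hx := h.x_nonneg
  have hκκ : κ ≤ κ ^ 2 := by nlinarith
  have hκx : κ * x ≤ κ ^ 2 * x := by gcongr
  have hκ2 : 1 ≤ κ ^ 2 := by nlinarith
  have htt : t ≤ κ ^ 2 * t := by nlinarith
  -- the spread of the iterates
  have hspread : ∀ N, IsOrthStack (S N) ∧ ∃ Q : Matrix (Fin d) (Fin d) ℝ, ∃ t', Qᵀ * Q = 1 ∧
      0 ≤ t' ∧ κ ^ 2 * t' ≤ 1 / 16 ∧ t' ≤ t + 7 / 3 * κ ^ 2 * x ∧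
      mean (fun i => ‖block (S N) i - Q‖ ^ 2) ≤ t' ^ 2 := by
    intro N
    induction N with
    | zero =>
      refine ⟨hS, Q₁, t, hQ₁, ht, htκ, ?_, hSt⟩
      have : 0 ≤ κ ^ 2 * x := by positivity
      linarith
    | succ N ih =>
      obtain ⟨hSN, Q, t', hQ, ht', htκ', -, hSt'⟩ := ih
      have hstep := (isGPMStep_iff hn).1 (hrun N)
      obtain ⟨P, hP⟩ := exists_isPolar (A * corr (fun i => A + Δ i) (block (S N)))
      refine ⟨isOrthStack_iff.2 fun i => (hstep i).ortho, P, 7 / 3 * κ ^ 2 * x, hP.ortho,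
        by positivity, ?_, by linarith, ?_⟩
      · have := h.small
        linarith
      · refine (mean_mono fun i => pow_le_pow_left₀ (norm_nonneg _) ?_ 2).trans
          (mean_const hn _).le
        exact h.norm_step_sub_le hn (isOrthStack_iff.1 hSN) hQ htκ'
          (norm_mean_sub_le hn ht' hSt') hP (hstep i)
  refine ⟨(hspread N).1, ?_⟩
  induction N with
  | zero => simp
  | succ N ih =>
    obtain ⟨hSN, Q, t', hQ, ht', htκ', htt', hSt'⟩ := hspread N
    refine (h.dF_step_le hn hfix hY1 hSN (hrun N) hQ ht' htκ' hSt').trans ?_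
    rw [pow_succ', mul_assoc (8 * κ ^ 2 * t + 12 * κ ^ 2 * x)]
    refine mul_le_mul ?_ ih (dF_nonneg _ _) (by positivity)
    linarith

end FixedPoint

end SmallNoise

end Procrustes

end

open Procrustes Matrix in
open scoped Matrix.Norms.L2Operator in
theorem theorem4p2 (n d m : ℕ) (hn : 0 < n) (hd : 0 < d)
    (A : Matrix (Fin d) (Fin m) ℝ) (Δ : Fin n → Matrix (Fin d) (Fin m) ℝ)
    (hA : 0 < Procrustes.sigmaMin A)
    (hΔ : (⨆ i, Procrustes.opNorm (Δ i)) ≤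
      Procrustes.sigmaMin A / (192 * Procrustes.kappa A ^ 3)) :
    ∃ Sinf : Matrix (Fin n × Fin d) (Fin d) ℝ,
      Procrustes.IsOrthStack Sinf ∧
      -- `Sinf` is a fixed point: `P_n(C Sinf)` is single-valued and equal to `Sinf`
      (∀ T, Procrustes.IsGPMStep (Procrustes.dataC A Δ) Sinf T ↔ T = Sinf) ∧
      -- `Sinf Sinfᵀ` is the unique global maximizer of the SDP
      Procrustes.IsUniqueSDPMaximizer (Procrustes.dataC A Δ) (Sinf * Sinf.transpose) ∧
      ∀ ε : ℝ, ε ≤ 1 / (16 * Procrustes.kappa A ^ 2 * √(d : ℝ)) →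
        Procrustes.rho A Δ ε < 1 ∧
        -- up to a global orthogonal factor, the basin has no fixed point other than `Sinf`
        (∀ S' ∈ Procrustes.Nbhd n d ε, Procrustes.IsGPMStep (Procrustes.dataC A Δ) S' S' →
          ∃ Q ∈ Matrix.orthogonalGroup (Fin d) ℝ, S' = Sinf * Q) ∧
        -- linear convergence of every run that starts in the basin, to no other limit
        ∀ S : ℕ → Matrix (Fin n × Fin d) (Fin d) ℝ,
          S 0 ∈ Procrustes.Nbhd n d ε → Procrustes.IsGPM (Procrustes.dataC A Δ) S →
          (∀ t, Procrustes.dF (S t) Sinf ≤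
            Procrustes.rho A Δ ε ^ t * Procrustes.dF (S 0) Sinf) ∧
          (∀ S', Procrustes.IsOrthStack S' →
            Filter.Tendsto (fun t => Procrustes.dF (S t) S') Filter.atTop (nhds 0) →
            ∃ Q ∈ Matrix.orthogonalGroup (Fin d) ℝ, S' = Sinf * Q) := by
  have : Nonempty (Fin d) := ⟨⟨0, hd⟩⟩
  have hn' : (0 : ℝ) < n := by exact_mod_cast hn
  have hsd : 0 < √(d : ℝ) := Real.sqrt_pos.2 (by exact_mod_cast hd)
  set κ := kappa A with hκdef
  set s := sigmaMin A with hsdef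
  set δ := ⨆ i, opNorm (Δ i) with hδdef
  set x := δ / opNorm A with hxdef
  -- `opNorm` is the operator norm `‖·‖` of `Matrix.Norms.L2Operator` by definition, which is used
  -- tacitly from here on
  have hδi : ∀ i, opNorm (Δ i) ≤ δ := le_ciSup (Finite.bddAbove_range _)
  have hδ0 : 0 ≤ δ := (norm_nonneg _).trans (hδi ⟨0, hn⟩)
  have hsa : s ≤ opNorm A := by
    have hv : 0 < l2 (Pi.single ⟨0, hd⟩ 1 : Fin d → ℝ) := l2_pos (by simp)
    have h1 := (sigmaMin_mul_l2_le hd A (Pi.single ⟨0, hd⟩ 1)).trans (l2_mulVec_le Aᵀ _)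
    rw [Procrustes.norm_transpose] at h1
    exact le_of_mul_le_mul_right h1 hv
  have ha : 0 < opNorm A := hA.trans_le hsa
  have hκ : 1 ≤ κ := (one_le_div hA).2 hsa
  have hκ0 : 0 < κ := by linarith
  have hκs : opNorm A = κ * s := (div_mul_cancel₀ _ hA.ne').symm
  have hδx : δ = κ * s * x := by rw [← hκs, hxdef]; field_simp
  have h : SmallNoise A Δ s κ x :=
    { s_pos := hA
      one_le := hκ
      x_nonneg := div_nonneg hδ0 ha.le
      small := by
        rw [hδx, le_div_iff₀ (by positivity)] at hΔ
        have : s * (κ ^ 4 * x) ≤ s * (1 / 192) := by linarith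
        exact le_of_mul_le_mul_left this hA
      norm_eq := hκs
      noise := fun i => (hδi i).trans hδx.le
      low := sigmaMin_mul_l2_le hd A }
  obtain ⟨Y, hfix, hY1⟩ := h.exists_fixedPoint hn
  have hYorth : IsOrthStack (stack Y) := isOrthStack_iff.2 fun i => (hfix i).ortho
  have hfixStep : ∀ T, IsGPMStep (dataC A Δ) (stack Y) T ↔ T = stack Y := fun T => by
    rw [isGPMStep_iff hn, block_stack]
    constructor
    · exact fun hT => block_injective (funext fun i => h.fixedPoint_unique hn hfix hY1 (hT i))
    · rintro rfl; exact hfix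
  refine ⟨stack Y, hYorth, hfixStep, h.isUniqueSDPMaximizer hn hfix hY1, fun ε hε => ?_⟩
  have htκ : κ ^ 2 * (ε * √(d : ℝ)) ≤ 1 / 16 := by
    rw [le_div_iff₀ (by positivity)] at hε
    linarith
  have hρ : rho A Δ ε = 8 * κ ^ 2 * (ε * √(d : ℝ)) + 12 * κ ^ 2 * x := by
    rw [rho, ← hκdef, ← hδdef, mul_div_assoc 3 δ, ← hxdef]; ring
  have hρ1 : rho A Δ ε < 1 := by
    have := h.pow_mul_le (j := 2) (by norm_num)
    rw [hρ]; linarith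
  have hconv : ∀ S : ℕ → Matrix (Fin n × Fin d) (Fin d) ℝ, S 0 ∈ Nbhd n d ε →
      IsGPM (dataC A Δ) S → ∀ t, 0 ≤ rho A Δ ε ∧ IsOrthStack (S t) ∧
        dF (S t) (stack Y) ≤ rho A Δ ε ^ t * dF (S 0) (stack Y) := by
    rintro S ⟨hS, hdist⟩ hrun t
    obtain ⟨Q, hQ, hdF⟩ := exists_dF_eq hn (S 0) (Y := Zmat n d)
      (isOrthStack_iff.2 fun i => by rw [Zmat, block_stack]; simp)
    have hε0 : 0 ≤ ε * √(d : ℝ) := by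
      have h1 := (dF_nonneg _ _).trans hdist
      rw [Real.sqrt_mul hn'.le, mul_left_comm] at h1
      exact nonneg_of_mul_nonneg_right h1 (Real.sqrt_pos.2 hn')
    have hspread : mean (fun i => ‖block (S 0) i - Q‖ ^ 2) ≤ (ε * √(d : ℝ)) ^ 2 := by
      have h1 : frob (S 0 - Zmat n d * Q) ^ 2 ≤ (ε * √((n : ℝ) * d)) ^ 2 :=
        pow_le_pow_left₀ (frob_nonneg _) (hdF ▸ hdist) 2
      rw [frob_sq_eq_mean hn, mul_pow, Real.sq_sqrt (by positivity)] at h1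
      have h2 : mean (fun i => frob (block (S 0 - Zmat n d * Q) i) ^ 2) ≤ ε ^ 2 * d :=
        le_of_mul_le_mul_left (by linarith) hn'
      rw [mul_pow, Real.sq_sqrt (by positivity)]
      refine (mean_mono fun i => ?_).trans h2
      rw [block_sub_mul, Zmat, block_stack, Matrix.one_mul]
      exact pow_le_pow_left₀ (norm_nonneg _) (norm_le_frob _) 2
    rw [hρ]
    have hx := h.x_nonneg
    exact ⟨by positivity, h.dF_run_le hn hfix hY1 hS hrun hQ.ortho hε0 htκ hspread t⟩
  have hzero : ∀ S : ℕ → Matrix (Fin n × Fin d) (Fin d) ℝ, S 0 ∈ Nbhd n d ε →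
      IsGPM (dataC A Δ) S → Filter.Tendsto (fun t => dF (S t) (stack Y)) Filter.atTop (nhds 0) := by
    intro S hS hrun
    have h0 := (hconv S hS hrun 0).1
    have := (tendsto_pow_atTop_nhds_zero_of_lt_one h0 hρ1).mul_const (dF (S 0) (stack Y))
    rw [zero_mul] at this
    exact squeeze_zero (fun _ => dF_nonneg _ _) (fun t => (hconv S hS hrun t).2.2) this
  refine ⟨hρ1, fun S' hS' hstep => ?_, fun S hS hrun => ⟨fun t => (hconv S hS hrun t).2.2, ?_⟩⟩
  · -- a fixed point is a constant run, so its distance to `stack Y` tends to zero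
    have := hzero (fun _ => S') hS' fun _ => hstep
    exact exists_eq_mul_of_dF_eq_zero hn hYorth (tendsto_nhds_unique tendsto_const_nhds this)
  · intro S' hS' hlim
    refine exists_eq_mul_of_dF_eq_zero hn hYorth (le_antisymm ?_ (dF_nonneg _ _))
    have := hlim.add (hzero S hS hrun)
    rw [add_zero] at this
    exact ge_of_tendsto' this fun t => dF_triangle hn hS' hYorth
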